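/- **Setting.** Let $U:\mathcal A\to\mathcal B$ be a functor with $\mathcal B$ locally finitely presentable. Assume that $U$ is a right multi-adjoint: every object $B$ of $\mathcal B$ has a small set $X_B$ of local units $\xi:B\to U(A_\xi)$ such that every $f:B\to U(A)$ factors as $f=U(L_A(f))\circ\xi$ for a unique $\xi\in X_B$ and a unique $L_A(f):A_\xi\to A$. A morphism of $\mathcal B$ is *diagonally universal* if it is (uniquely) left orthogonal to all $U(h)$, $h$ a morphism of $\mathcal A$. For $B\in\mathcal B$ let $\mathcal D_B$ be the full subcategory of the coslice $B\downarrow\mathcal B$ on the pushouts, along morphisms $K\to B$, of diagonally universal morphisms $K\to K'$ between finitely presented objects. For $n\in\mathcal D_B$ and $\xi\in X_B$ (or $\xi$ any morphism under $B$) write $n\le\xi$ if $\xi$ factors through $n$, and let $V_\xi=\{n\in\mathcal D_B\mid n\le\xi\}$. Assume *Diers' condition*: for all $B$ and $\xi\in X_B$, the full subcategory $V_\xi$ of $B\downarrow\mathcal B$ is filtered and $\xi$ is its colimit, $\xi=\operatorname{colim}_{n\in V_\xi}n$. The set $X_B$ has the topology generated by the sets $D_n=\{\xi\mid n\le\xi\}$,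 $n\in\mathcal D_B$. A *$\mathcal B$-space* is a topological space $X$ with a sheaf $\mathbb B$ of $\mathcal B$-objects; a morphism $(X_1,\mathbb B_1)\to(X_2,\mathbb B_2)$ is a continuous map $f:X_2\to X_1$ with a morphism of sheaves $\phi^\sharp:\mathbb B_1\to f_*\mathbb B_2$, which induces maps $\phi^\flat_x:\mathbb B_1|_{f(x)}\to\mathbb B_2|_x$ of stalks. A *$U$-space* is a $\mathcal B$-space $(X,\mathbb A)$ with objects $A_x\in\mathcal A$ and isomorphisms $\mathbb A|_x\simeq U(A_x)$, $x\in X$; a morphism of $U$-spaces is a morphism of $\mathcal B$-spaces with morphisms $u_x:A^1_{f(x)}\to A^2_x$ of $\mathcal A$ such that $\phi^\flat_x=U(u_x)$ for all $x$ (modulo the given isomorphisms). Let $\iota_U:U\text{-Spaces}\to\mathcal B\text{-Spaces}$ be the forgetful functor. For a $\mathcal B$-space $(X,\mathbb B)$ with canonical maps $q^u_x:\mathbb B(u)\to\mathbb B|_x$, let $\mathcal D_{\mathbb B}$ be the category of pairs $(u,n)$ with $u\subseteq X$ open and $n\in\mathcal D_{\mathbb B(u)}$; a morphism $(u,n)\to(v,m)$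 is an inclusion $v\subseteq u$ with a morphism $\operatorname{cod}(n)\to\operatorname{cod}(m)$ over the restriction $\mathbb B(u)\to\mathbb B(v)$. Let $X_{\mathbb B}=\{(x,\xi)\mid x\in X,\ \xi\in X_{\mathbb B|_x}\}$, with the topology $\tau_{\mathbb B}$ generated by the sets $D_{(u,n)}=\{(x,\xi)\mid x\in u,\ (q^u_x)_*n\le\xi\}$, $(u,n)\in\mathcal D_{\mathbb B}$, where $(q^u_x)_*n$ is the pushout of $n$ along $q^u_x$. **Theorem.** (1) For every $\mathcal B$-space $(X,\mathbb B)$ the sets $D_{(u,n)}$ form a basis of $\tau_{\mathbb B}$, and for each $x\in X$ the map $\xi\mapsto(x,\xi)$ is a topological embedding $X_{\mathbb B|_x}\to X_{\mathbb B}$. The functor $\operatorname{cod}:\mathcal D_{\mathbb B}\to\mathcal B$ has a pointwise left Kan extension along $D:\mathcal D_{\mathbb B}\to\tau_{\mathbb B}^{op}$, $(u,n)\mapsto D_{(u,n)}$, this presheaf has a sheafification $\widetilde{\mathbb B}$, and there are isomorphisms $\widetilde{\mathbb B}|_{(x,\xi)}\simeq U(A_\xi)$ for which, whenever $(x,\xi)\in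 D_{(u,n)}$, the composite $\operatorname{cod}(n)\to\widetilde{\mathbb B}(D_{(u,n)})\to\widetilde{\mathbb B}|_{(x,\xi)}\simeq U(A_\xi)$ is equal to every $g$ with $g\circ n=\xi\circ q^u_x$. So $\operatorname{Spec}(X,\mathbb B)=((X_{\mathbb B},\tau_{\mathbb B}),\widetilde{\mathbb B},(A_\xi)_{(x,\xi)})$ is a $U$-space. (2) For any choice of these data, $\operatorname{Spec}$ is a functor $\mathcal B\text{-Spaces}\to U\text{-Spaces}$, which sends $(f,\phi):(X_1,\mathbb B_1)\to(X_2,\mathbb B_2)$ to the morphism that is $(x,\xi)\mapsto(f(x),\xi')$ on points, where $\xi'$ is the local unit through which $\xi\circ\phi^\flat_x$ factors, that is $L_{A_\xi}(\xi\circ\phi^\flat_x)$ on the local objects, and for which the inverse image of $D_{(u,n)}$ is $D_{(f^{-1}(u),m)}$ for every pushout $m$ of $n$ along $\phi^\sharp_u$, the comorphism on $D_{(u,n)}$ being given, on the image of $\operatorname{cod}(n)$, by the pushout map $\operatorname{cod}(n)\to\operatorname{cod}(m)$. (3) $\operatorname{Spec}$ is left adjoint to $\iota_U$. The unit $(X,\mathbb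 B)\to\iota_U\operatorname{Spec}(X,\mathbb B)$ is the projection $(x,\xi)\mapsto x$ on points, and its comorphism at $u$, followed by the restriction to $D_{(u,n)}$, is $\mathbb B(u)\xrightarrow{\,n\,}\operatorname{cod}(n)\to\widetilde{\mathbb B}(D_{(u,n)})$. -/

import Mathlib

open CategoryTheory CategoryTheory.Limits TopologicalSpace Opposite AlgebraicGeometry

universe v u v' u'

noncomputable section

namespace Diers

variable {𝒜 : Type u'} [Category.{v'} 𝒜] {ℬ : Type u} [Category.{v} ℬ]

/-! ### Right multi-adjoints and diagonally universal morphisms -/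

/-- The structure of a right multi-adjoint on `U : 𝒜 ⥤ ℬ`: under every object `B` a small family of
local units `B ⟶ U (A_ξ)`, indexed by a set `X_B`, such that every `B ⟶ U A` factors uniquely
through a unique local unit. -/
structure LocalUnits (U : 𝒜 ⥤ ℬ) where
  /-- the set `X_B` of (indices of) local units under `B` -/
  Idx : ℬ → Type v
  /-- the local object `A_ξ` -/
  obj : ∀ {B : ℬ}, Idx B → 𝒜
  /-- the local unit `ξ : B ⟶ U (A_ξ)` -/
  unit : ∀ {B : ℬ} (ξ : Idx B), B ⟶ U.obj (obj ξ)
  existsUnique_fac : ∀ {B : ℬ} {A : 𝒜} (f : B ⟶ U.obj A),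
    ∃! p : Σ ξ : Idx B, (obj ξ ⟶ A), unit p.1 ≫ U.map p.2 = f

namespace LocalUnits

variable {U : 𝒜 ⥤ ℬ} (L : LocalUnits U) {B : ℬ} {A : 𝒜}

/-- The index of the local unit through which `f : B ⟶ U A` factors. -/
def idx (f : B ⟶ U.obj A) : L.Idx B := (L.existsUnique_fac f).choose.1

/-- The local part `L_A(f) : A_f ⟶ A` of the factorization of `f : B ⟶ U A`. -/
def lift (f : B ⟶ U.obj A) : L.obj (L.idx f) ⟶ A := (L.existsUnique_fac f).choose.2

lemma fac (f : B ⟶ U.obj A) : L.unit (L.idx f) ≫ U.map (L.lift f) = f :=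
  (L.existsUnique_fac f).choose_spec.1

end LocalUnits

/-- `n` is diagonally universal: it is (uniquely) left orthogonal to all morphisms `U f`. -/
def IsDiagUniversal (U : 𝒜 ⥤ ℬ) {B C : ℬ} (n : B ⟶ C) : Prop :=
  ∀ ⦃A A' : 𝒜⦄ (f : A ⟶ A') (a : B ⟶ U.obj A) (c : C ⟶ U.obj A'), a ≫ U.map f = n ≫ c →
    ∃! d : C ⟶ U.obj A, n ≫ d = a ∧ d ≫ U.map f = c

/-- `n : B ⟶ C` belongs to `𝒟_B` (a diagonally universal morphism of finite presentation): it is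
the pushout, along some `K ⟶ B`, of a diagonally universal morphism `K ⟶ K'` between finitely
presented objects. -/
def IsBasic (U : 𝒜 ⥤ ℬ) {B C : ℬ} (n : B ⟶ C) : Prop :=
  ∃ (K K' : ℬ) (l : K ⟶ K') (a : K ⟶ B) (b : K' ⟶ C),
    IsFinitelyPresentable.{v} K ∧ IsFinitelyPresentable.{v} K' ∧
    IsDiagUniversal U l ∧ IsPushout a l n b

variable {U : 𝒜 ⥤ ℬ} (L : LocalUnits U)

/-- The objects of `V_ξ = {n ∈ 𝒟_B | n ≤ ξ}`, where `n ≤ ξ` means that the local unit `ξ` factors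
through `n`. -/
def below {B : ℬ} (ξ : L.Idx B) : ObjectProperty (Under B) := fun n =>
  IsBasic U n.hom ∧ ∃ g : n.right ⟶ U.obj (L.obj ξ), n.hom ≫ g = L.unit ξ

/-- Diers' condition: every local unit `ξ` under every object `B` is, in the coslice under `B`, the
filtered colimit of `V_ξ`, seen as a full subcategory of the coslice. -/
def DiersCondition : Prop :=
  ∀ (B : ℬ) (ξ : L.Idx B), IsFiltered (below L ξ).FullSubcategory ∧
    ∃ α : (below L ξ).ι ⟶ (Functor.const _).obj (Under.mk (L.unit ξ)),
      Nonempty (IsColimit (Cocone.mk _ α))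

/-- The spectral topology on the set `X_B` of local units, generated by the
`D_n = {ξ | n ≤ ξ}` for `n ∈ 𝒟_B`. -/
abbrev spectralTopology (B : ℬ) : TopologicalSpace (L.Idx B) :=
  TopologicalSpace.generateFrom
    {s | ∃ n : Under B, IsBasic U n.hom ∧
      s = {ξ | ∃ g : n.right ⟶ U.obj (L.obj ξ), n.hom ≫ g = L.unit ξ}}

/-! ### `ℬ`-spaces and `U`-spaces -/

/-- The category of `ℬ`-spaces. A morphism `(X₁, 𝔹₁) ⟶ (X₂, 𝔹₂)` consists of a continuous map
`f : X₂ ⟶ X₁` and of a morphism of sheaves `𝔹₁ ⟶ f_* 𝔹₂`: this is the opposite of Mathlib's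
convention for sheafed spaces. -/
abbrev BSpace (ℬ : Type u) [Category.{v} ℬ] : Type (max u (v + 1)) :=
  (SheafedSpace.{u, v, v} ℬ)ᵒᵖ

variable [HasColimits ℬ]

/-- A `U`-space: a space with a sheaf of `ℬ`-objects and local objects `A_x` with specified
isomorphisms from the stalks to the `U (A_x)`. -/
structure USpace (U : 𝒜 ⥤ ℬ) where
  /-- the underlying space with its sheaf -/
  space : SheafedSpace.{u, v, v} ℬ
  /-- the local objects -/
  loc : space → 𝒜
  /-- the identification of the stalks -/
  stalkIso : ∀ x : space, space.presheaf.stalk x ≅ U.obj (loc x)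

namespace USpace

/-- A morphism of `U`-spaces `X₁ ⟶ X₂`: a continuous map `f : X₂ ⟶ X₁` with a comorphism of
sheaves, and local maps `A¹_{f x} ⟶ A²_x` that induce the maps at the stalks. -/
@[ext]
structure Hom (X₁ X₂ : USpace U) where
  /-- the continuous map together with the comorphism -/
  hom : X₂.space ⟶ X₁.space
  /-- the local maps -/
  loc : ∀ x : X₂.space, X₁.loc (hom.hom.base x) ⟶ X₂.loc x
  comm : ∀ x : X₂.space, hom.hom.stalkMap x ≫ (X₂.stalkIso x).hom =
    (X₁.stalkIso (hom.hom.base x)).hom ≫ U.map (loc x)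

lemma comm_comp {ℬ : Type u} [Category.{v} ℬ] (U : 𝒜 ⥤ ℬ) {P Q R : ℬ} {X Y Z : 𝒜}
    {s : P ⟶ Q} {t : Q ⟶ R} {i : P ⟶ U.obj X} {j : Q ⟶ U.obj Y} {k : R ⟶ U.obj Z}
    (f : X ⟶ Y) (g : Y ⟶ Z) (h₁ : s ≫ j = i ≫ U.map f) (h₂ : t ≫ k = j ≫ U.map g) :
    (s ≫ t) ≫ k = i ≫ U.map (f ≫ g) := by
  rw [Category.assoc, h₂, ← Category.assoc, h₁, U.map_comp, Category.assoc]

instance : Category (USpace U) where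
  Hom := Hom
  id X :=
    { hom := 𝟙 X.space
      loc := fun x => 𝟙 (X.loc x)
      comm := fun x => by
        have h := PresheafedSpace.stalkMap.id X.space.toPresheafedSpace x
        have h' : (𝟙 X.space : X.space ⟶ X.space).hom.stalkMap x =
          𝟙 (X.space.presheaf.stalk x) := h
        exact (congrArg (fun t => t ≫ (X.stalkIso x).hom) h').trans
          ((Category.id_comp _).trans
            ((Category.comp_id _).symm.trans (congrArg _ (U.map_id _).symm))) }
  comp {X Y Z} f g :=
    { hom := g.hom ≫ f.hom
      loc := fun x => f.loc (g.hom.hom.base x) ≫ g.loc x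
      comm := fun x => by
        have h := PresheafedSpace.stalkMap.comp g.hom.hom f.hom.hom x
        have h' : (g.hom ≫ f.hom).hom.stalkMap x =
          f.hom.hom.stalkMap (g.hom.hom.base x) ≫ g.hom.hom.stalkMap x := h
        exact (congrArg (fun t => t ≫ (Z.stalkIso x).hom) h').trans
          (comm_comp U _ _ (f.comm (g.hom.hom.base x)) (g.comm x)) }
  id_comp f := by
    apply Hom.ext
    · exact Category.comp_id f.hom
    · exact heq_of_eq (funext fun x => Category.id_comp _)
  comp_id f := by
    apply Hom.ext
    · exact Category.id_comp f.hom
    · exact heq_of_eq (funext fun x => Category.comp_id _)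
  assoc f g h := by
    apply Hom.ext
    · exact (Category.assoc h.hom g.hom f.hom).symm
    · exact heq_of_eq (funext fun x => Category.assoc _ _ _)

end USpace

/-- The functor `ι_U` from `U`-spaces to `ℬ`-spaces that forgets the local objects and maps. -/
def forgetLocal (U : 𝒜 ⥤ ℬ) : USpace U ⥤ BSpace ℬ where
  obj X := op X.space
  map f := (USpace.Hom.hom f).op
  map_id _ := rfl
  map_comp _ _ := rfl

/-! ### The Diers space of a `ℬ`-space -/

/-- The points `(x, ξ)` of the Diers space of `𝔹`: a point `x` and a local unit `ξ` under the
stalk at `x`. -/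
def Point (𝔹 : SheafedSpace.{u, v, v} ℬ) : Type v :=
  Σ x : 𝔹, L.Idx (𝔹.presheaf.stalk x)

/-- The objects `(u, n)` of `𝒟_𝔹`: an open `u` and some `n ∈ 𝒟_{𝔹(u)}`. -/
structure BasicPair (U : 𝒜 ⥤ ℬ) (𝔹 : SheafedSpace.{u, v, v} ℬ) where
  /-- the open `u` -/
  u : Opens 𝔹
  /-- the codomain of `n` -/
  cod : ℬ
  /-- the morphism `n` -/
  n : 𝔹.presheaf.obj (op u) ⟶ cod
  isBasic : IsBasic U n

/-- A morphism `(u, n) ⟶ (v, m)` of `𝒟_𝔹`: an inclusion `v ⊆ u` and a morphism from the codomain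
of `n` to that of `m` over the restriction `𝔹(u) ⟶ 𝔹(v)`; equivalently, a morphism in
`𝒟_{𝔹(v)}` from the pushout of `n` along the restriction to `m`. -/
@[ext]
structure BasicPair.Hom {𝔹 : SheafedSpace.{u, v, v} ℬ} (p q : BasicPair U 𝔹) where
  le : q.u ≤ p.u
  /-- the morphism of the codomains -/
  map : p.cod ⟶ q.cod
  w : p.n ≫ map = 𝔹.presheaf.map (homOfLE le).op ≫ q.n

instance (𝔹 : SheafedSpace.{u, v, v} ℬ) : Category (BasicPair U 𝔹) where
  Hom := BasicPair.Hom
  id p := ⟨le_rfl, 𝟙 _, by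
    rw [Category.comp_id, show (homOfLE (le_refl p.u)).op = 𝟙 (op p.u) from rfl,
      𝔹.presheaf.map_id, Category.id_comp]⟩
  comp {p q r} f g := ⟨g.le.trans f.le, f.map ≫ g.map, by
    rw [← Category.assoc, f.w, Category.assoc, g.w, ← Category.assoc, ← 𝔹.presheaf.map_comp]
    rfl⟩
  id_comp f := BasicPair.Hom.ext (Category.id_comp f.map)
  comp_id f := BasicPair.Hom.ext (Category.comp_id f.map)
  assoc f g h := BasicPair.Hom.ext (Category.assoc f.map g.map h.map)

/-- The codomain functor `𝒟_𝔹 ⥤ ℬ`. -/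
def codFunctor (U : 𝒜 ⥤ ℬ) (𝔹 : SheafedSpace.{u, v, v} ℬ) : BasicPair U 𝔹 ⥤ ℬ where
  obj p := p.cod
  map f := BasicPair.Hom.map f
  map_id _ := rfl
  map_comp _ _ := rfl

variable {𝔹 : SheafedSpace.{u, v, v} ℬ}

/-- `D_(u,n)`: the points `(x, ξ)` with `x ∈ u` such that the composite `𝔹(u) ⟶ 𝔹_x ⟶ U (A_ξ)`
factors through `n`; equivalently, the pushout of `n` along `𝔹(u) ⟶ 𝔹_x` is `≤ ξ`, see
`mem_basicSet_iff`. -/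
def basicSet (p : BasicPair U 𝔹) : Set (Point L 𝔹) :=
  {y | ∃ (hx : y.1 ∈ p.u) (g : p.cod ⟶ U.obj (L.obj y.2)),
    p.n ≫ g = 𝔹.presheaf.germ p.u y.1 hx ≫ L.unit y.2}

lemma mem_basicSet_iff (p : BasicPair U 𝔹) (y : Point L 𝔹) :
    y ∈ basicSet L p ↔ ∃ (hx : y.1 ∈ p.u)
      (g : pushout p.n (𝔹.presheaf.germ p.u y.1 hx) ⟶ U.obj (L.obj y.2)),
      pushout.inr p.n (𝔹.presheaf.germ p.u y.1 hx) ≫ g = L.unit y.2 := by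
  constructor
  · rintro ⟨hx, g, hg⟩
    exact ⟨hx, pushout.desc g (L.unit y.2) hg, pushout.inr_desc _ _ _⟩
  · rintro ⟨hx, g, hg⟩
    exact ⟨hx, pushout.inl _ _ ≫ g, by rw [pushout.condition_assoc, hg]⟩

/-- The topology of the Diers space, generated by the `D_(u,n)`. -/
instance : TopologicalSpace (Point L 𝔹) :=
  TopologicalSpace.generateFrom (Set.range (basicSet L (𝔹 := 𝔹)))

variable (𝔹) in
/-- The inclusion `ξ ↦ (x, ξ)` of the local units under the stalk at `x`. -/
def stalkInclusion (x : 𝔹) (ξ : L.Idx (𝔹.presheaf.stalk x)) : Point L 𝔹 := ⟨x, ξ⟩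

variable (𝔹) in
/-- The Diers space of a `ℬ`-space. -/
def diersSpace : TopCat.{v} := TopCat.of (Point L 𝔹)

/-- `D_(u,n)` as an open of the Diers space. -/
def basicOpen (p : BasicPair U 𝔹) : Opens (diersSpace L 𝔹) :=
  ⟨basicSet L p, TopologicalSpace.isOpen_generateFrom_of_mem ⟨p, rfl⟩⟩

lemma basicOpen_anti {p q : BasicPair U 𝔹} (f : p ⟶ q) : basicOpen L q ≤ basicOpen L p := by
  rintro y ⟨hx, g, hg⟩
  refine ⟨BasicPair.Hom.le f hx, BasicPair.Hom.map f ≫ g, ?_⟩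
  rw [← Category.assoc, BasicPair.Hom.w f, Category.assoc, hg, ← Category.assoc,
    TopCat.Presheaf.germ_res]

variable (𝔹) in
/-- The functor `D : 𝒟_𝔹 ⥤ τ_𝔹ᵒᵖ`. -/
def basicOpenFunctor : BasicPair U 𝔹 ⥤ (Opens (diersSpace L 𝔹))ᵒᵖ where
  obj p := op (basicOpen L p)
  map f := (homOfLE (basicOpen_anti L f)).op
  map_id _ := rfl
  map_comp _ _ := rfl

/-! ### The structural sheaf and the spectrum -/

variable (𝔹) in
/-- A structural sheaf of `𝔹`: a pointwise left Kan extension `pre` of the codomain functor along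
`D : 𝒟_𝔹 ⥤ τ_𝔹ᵒᵖ`, a sheafification `γ : pre ⟶ sheaf` of it, and the identification of the stalk
at `(x, ξ)` with `U (A_ξ)` that is compatible with the factorizations of `ξ` through the
`n` with `(x, ξ) ∈ D_(u,n)`. All of it is unique up to unique isomorphism. -/
structure StructuralSheaf where
  /-- the structural presheaf -/
  pre : TopCat.Presheaf ℬ (diersSpace L 𝔹)
  /-- the universal transformation of the Kan extension -/
  ζ : codFunctor U 𝔹 ⟶ basicOpenFunctor L 𝔹 ⋙ pre
  /-- the universal property of the Kan extension -/
  isKan : (Functor.LeftExtension.mk pre ζ).IsPointwiseLeftKanExtension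
  /-- the structural sheaf -/
  sheaf : TopCat.Presheaf ℬ (diersSpace L 𝔹)
  isSheaf : sheaf.IsSheaf
  /-- the unit of the sheafification -/
  γ : pre ⟶ sheaf
  isSheafification : ∀ (G : TopCat.Presheaf ℬ (diersSpace L 𝔹)), G.IsSheaf →
    ∀ α : pre ⟶ G, ∃! β : sheaf ⟶ G, γ ≫ β = α
  /-- the identification of the stalks -/
  stalkIso : ∀ y : diersSpace L 𝔹, sheaf.stalk y ≅ U.obj (L.obj (Sigma.snd y))
  germ_stalkIso : ∀ (p : BasicPair U 𝔹) (y : diersSpace L 𝔹) (hy : y ∈ basicOpen L p)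
    (hx : Sigma.fst y ∈ p.u) (g : p.cod ⟶ U.obj (L.obj (Sigma.snd y))),
    p.n ≫ g = 𝔹.presheaf.germ p.u (Sigma.fst y) hx ≫ L.unit (Sigma.snd y) →
    (ζ.app p ≫ γ.app (op (basicOpen L p))) ≫ sheaf.germ (basicOpen L p) y hy ≫
      (stalkIso y).hom = g

namespace StructuralSheaf

variable {L}

/-- The canonical map from the codomain of `n` to the sections of the structural sheaf over
`D_(u,n)`. -/
def toSections (S : StructuralSheaf L 𝔹) (p : BasicPair U 𝔹) :
    p.cod ⟶ S.sheaf.obj (op (basicOpen L p)) :=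
  S.ζ.app p ≫ S.γ.app (op (basicOpen L p))

/-- The spectrum of `𝔹` as a `U`-space. -/
def spectrum (S : StructuralSheaf L 𝔹) : USpace U where
  space :=
    { carrier := diersSpace L 𝔹
      presheaf := S.sheaf
      IsSheaf := S.isSheaf }
  loc y := L.obj (Sigma.snd y)
  stalkIso := S.stalkIso

end StructuralSheaf

/-- The action on points of the spectrum of a morphism of `ℬ`-spaces: `(x, ξ)` goes to `f x` with
the local unit through which `𝔹₁_{f x} ⟶ 𝔹₂_x ⟶ U (A_ξ)` factors. -/
def specPoint {𝔹₁ 𝔹₂ : BSpace ℬ} (φ : 𝔹₁ ⟶ 𝔹₂) (y : Point L 𝔹₂.unop) : Point L 𝔹₁.unop :=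
  ⟨φ.unop.hom.base y.1, L.idx (φ.unop.hom.stalkMap y.1 ≫ L.unit y.2)⟩

/-- The local part of that factorization. -/
def specLoc {𝔹₁ 𝔹₂ : BSpace ℬ} (φ : 𝔹₁ ⟶ 𝔹₂) (y : Point L 𝔹₂.unop) :
    L.obj (specPoint L φ y).2 ⟶ L.obj y.2 :=
  L.lift (φ.unop.hom.stalkMap y.1 ≫ L.unit y.2)

variable {L}

/-- The spectrum functor, relatively to a choice `S` of structural sheaves. On a morphism it is
given by `specPoint` on points, by `specLoc` on the local objects, and on the basic opens by the
pushouts `m` of the `n` along `𝔹₁(u) ⟶ 𝔹₂(f⁻¹ u)`. -/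
structure SpecFunctor (S : ∀ 𝔹 : SheafedSpace.{u, v, v} ℬ, StructuralSheaf L 𝔹) where
  /-- the functor on morphisms -/
  map : ∀ {𝔹₁ 𝔹₂ : BSpace ℬ}, (𝔹₁ ⟶ 𝔹₂) → ((S 𝔹₁.unop).spectrum ⟶ (S 𝔹₂.unop).spectrum)
  map_id : ∀ 𝔹 : BSpace ℬ, map (𝟙 𝔹) = 𝟙 _
  map_comp : ∀ {𝔹₁ 𝔹₂ 𝔹₃ : BSpace ℬ} (φ : 𝔹₁ ⟶ 𝔹₂) (ψ : 𝔹₂ ⟶ 𝔹₃),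
    map (φ ≫ ψ) = map φ ≫ map ψ
  map_point : ∀ {𝔹₁ 𝔹₂ : BSpace ℬ} (φ : 𝔹₁ ⟶ 𝔹₂) (y : diersSpace L 𝔹₂.unop),
    ∃ h : (map φ).hom.hom.base y = specPoint L φ y,
      (map φ).loc y =
        eqToHom (congrArg (fun z : Point L 𝔹₁.unop => L.obj z.2) h) ≫ specLoc L φ y
  map_sections : ∀ {𝔹₁ 𝔹₂ : BSpace ℬ} (φ : 𝔹₁ ⟶ 𝔹₂) (p : BasicPair U 𝔹₁.unop) (C : ℬ)
    (m : 𝔹₂.unop.presheaf.obj (op ((Opens.map φ.unop.hom.base).obj p.u)) ⟶ C)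
    (hm : IsBasic U m) (k : p.cod ⟶ C),
    IsPushout (φ.unop.hom.c.app (op p.u)) p.n m k →
    ∃ h : (Opens.map (map φ).hom.hom.base).obj (basicOpen L p) =
        basicOpen L ⟨(Opens.map φ.unop.hom.base).obj p.u, C, m, hm⟩,
      (S 𝔹₁.unop).toSections p ≫ (map φ).hom.hom.c.app (op (basicOpen L p)) =
        k ≫ (S 𝔹₂.unop).toSections ⟨(Opens.map φ.unop.hom.base).obj p.u, C, m, hm⟩ ≫
          (S 𝔹₂.unop).sheaf.map (homOfLE h.le).op

/-- The underlying functor from `ℬ`-spaces to `U`-spaces. -/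
def SpecFunctor.functor {S : ∀ 𝔹 : SheafedSpace.{u, v, v} ℬ, StructuralSheaf L 𝔹}
    (F : SpecFunctor S) : BSpace ℬ ⥤ USpace U where
  obj 𝔹 := (S 𝔹.unop).spectrum
  map φ := F.map φ
  map_id := F.map_id
  map_comp := F.map_comp

/-- `η : 𝔹 ⟶ ι_U (Spec 𝔹)` is the canonical morphism: it is the projection `(x, ξ) ↦ x` on points,
and its comorphism `𝔹(u) ⟶ 𝔹~(η⁻¹ u)` restricts on `D_(u,n) ⊆ η⁻¹ u` to the composite of `n` with
the canonical map from the codomain of `n` to `𝔹~(D_(u,n))`. -/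
def IsCanonicalUnit {𝔹 : BSpace ℬ} (S : StructuralSheaf L 𝔹.unop)
    (η : 𝔹 ⟶ (forgetLocal U).obj S.spectrum) : Prop :=
  (∀ y : diersSpace L 𝔹.unop, η.unop.hom.base y = Sigma.fst y) ∧
  ∀ p : BasicPair U 𝔹.unop,
    ∃ h : basicOpen L p ≤ (Opens.map η.unop.hom.base).obj p.u,
      η.unop.hom.c.app (op p.u) ≫ S.sheaf.map (homOfLE h).op = p.n ≫ S.toSections p

end Diers

end

/-! Two facts about a basic morphism `n : B ⟶ C` carry the proof. The first is uniqueness. Although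
`n` need not be epi, Diers' condition makes it epic against the objects `U A`: a second
factorization of a local unit `ξ` through `n` is determined on a finitely presented object, so it is
already visible at a stage of the filtered colimit `ξ = colim V_ξ`, where it becomes a morphism of
`V_ξ` and hence agrees with the cocone (`DiersCondition.eq_ι`, `IsBasic.hom_ext`). Checking on germs
extends this to sections of sheaves whose stalks are of the form `U A`. The second is spreading out.
Since `n` is a pushout of a morphism between finitely presented objects, a factorization through `n`
at a stalk extends to a neighbourhood, and by uniqueness such local factorizations glue
(`IsBasic.exists_factorization`).

The structural sheaf is characterized by `IsUniversalFamily`: its morphisms to a sheaf are the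
compatible families of morphisms from the `cod n` to the sections over the `D_(u,n)`. Testing
against skyscraper sheaves shows that its stalk at `(x, ξ)` is the colimit of the `cod n` over the
`(u, n)` with `(x, ξ) ∈ D_(u,n)`. Now `U (A_ξ)` is the colimit of `V_ξ`, each object of `V_ξ` is a
pushout of some `(u, n)` along a germ map, and such a pushout is the filtered colimit of the
restrictions of `(u, n)` to the neighbourhoods of `x`. So `U (A_ξ)` is the same colimit.

For the adjunction, a morphism from `𝔹` to a `U`-space `Y` gives at each `y` a morphism from a stalk
of `𝔹` to `U (A_y)`. Its factorization through a local unit dictates the point of the spectrum and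
the local map. Spreading out gives continuity, and the glued factorizations over the preimages of
the `D_(u,n)` form a family that induces the comorphism; uniqueness of factorizations gives
uniqueness of the lift. The functor `Spec` on morphisms and its laws follow from this universal
property. -/

set_option linter.overlappingInstances false

noncomputable section

namespace Diers

section

/-! ### Limits and sheafification in locally finitely presentable categories -/

section LocallyFinitelyPresentable

variable {ℬ : Type u} [Category.{v} ℬ]

/-- A locally finitely presentable category is a reflective subcategory of a category of
presheaves, hence it has limits. -/
theorem hasLimits_of_isLocallyFinitelyPresentable [IsLocallyFinitelyPresentable.{v} ℬ] :
    HasLimits ℬ := by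
  let P := ObjectProperty.isFinitelyPresentable.{v} ℬ
  have : EssentiallySmall.{v} P.FullSubcategory := inferInstance
  let A : SmallModel.{v} P.FullSubcategory ⥤ ℬ := (equivSmallModel.{v} P.FullSubcategory).inverse ⋙ P.ι
  have : A.IsDense := inferInstance
  let R := Presheaf.restrictedULiftYoneda.{v} A
  have : R.IsRightAdjoint :=
    (Presheaf.uliftYonedaAdjunction.{v} (uliftYoneda.{v}.leftKanExtension A)
      (uliftYoneda.{v}.leftKanExtensionUnit A)).isRightAdjoint
  let _ : Reflective R := { L := R.leftAdjoint, adj := Adjunction.ofIsRightAdjoint R }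
  exact hasLimits_of_reflective R

theorem coprod_isFinitelyPresentable [HasColimits ℬ] (K K' : ℬ)
    (hK : IsFinitelyPresentable.{v} K) (hK' : IsFinitelyPresentable.{v} K') :
    IsFinitelyPresentable.{v} (K ⨿ K') := by
  have := Cardinal.fact_isRegular_aleph0
  have : ∀ k, IsFinitelyPresentable.{v} ((pair K K').obj k) := by
    rintro ⟨_ | _⟩ <;> dsimp <;> infer_instance
  exact isCardinalPresentable_of_isColimit.{v} _ (colimit.isColimit (pair K K')) Cardinal.aleph0.{v}
    ((hasCardinalLT_aleph0_iff _).2 inferInstance)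

theorem initial_isFinitelyPresentable [HasColimits ℬ] :
    IsFinitelyPresentable.{v} (⊥_ ℬ) := by
  have := Cardinal.fact_isRegular_aleph0
  have : ∀ k, IsFinitelyPresentable.{v} ((Functor.empty.{0} ℬ).obj k) := by
    rintro ⟨⟨⟩⟩
  exact isCardinalPresentable_of_isColimit.{v} _ (colimit.isColimit (Functor.empty.{0} ℬ))
    Cardinal.aleph0.{v} ((hasCardinalLT_aleph0_iff _).2 inferInstance)

/-- Any test object `E` is a colimit of finitely presented ones. The amalgamations along the legs
exist by hypothesis, and their uniqueness makes them a cocone, which yields the amalgamation on `E`.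
-/
theorem isSheaf_of_isFinitelyPresentable [IsLocallyFinitelyPresentable.{v} ℬ] {C : Type v}
    [SmallCategory C] (J : GrothendieckTopology C) (P : Cᵒᵖ ⥤ ℬ)
    (h : ∀ K : ℬ, IsFinitelyPresentable.{v} K →
      Presieve.IsSheaf J (P ⋙ coyoneda.obj (op K))) : Presheaf.IsSheaf J P := by
  have := Cardinal.fact_isRegular_aleph0
  intro E X S hS x hx
  obtain ⟨I, _, _, ⟨p⟩⟩ := (isCardinalFilteredGenerator_isCardinalPresentable ℬ
    Cardinal.aleph0.{v}).exists_colimitsOfShape E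
  have hfam (i : I) := h (p.diag.obj i) (p.prop_diag_obj i) S hS
    (fun Y f hf => p.ι.app i ≫ (show E ⟶ P.obj (op Y) from x f hf)) (by
      intro Y₁ Y₂ Z g₁ g₂ f₁ f₂ h₁ h₂ w
      have := hx g₁ g₂ h₁ h₂ w
      simpa using! congr(p.ι.app i ≫ $this))
  choose t ht htu using hfam
  have ht' (i : I) ⦃Y : C⦄ (f : Y ⟶ X) (hf : S f) :
    (show p.diag.obj i ⟶ P.obj (op X) from t i) ≫ P.map f.op =
      p.ι.app i ≫ (show E ⟶ P.obj (op Y) from x f hf) := ht i f hf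
  let c : Cocone p.diag :=
    { pt := P.obj (op X)
      ι :=
        { app := t
          naturality := by
            intro i j a
            refine (htu i (p.diag.map a ≫ (show p.diag.obj j ⟶ P.obj (op X) from t j)) ?_).trans
              (Category.comp_id _).symm
            intro Y f hf
            change (p.diag.map a ≫ (show p.diag.obj j ⟶ P.obj (op X) from t j)) ≫ P.map f.op =
              p.ι.app i ≫ (show E ⟶ P.obj (op Y) from x f hf)
            rw [Category.assoc, ht' j f hf, ← Category.assoc, p.ι.naturality]
            simp } }
  have hc (i : I) : p.ι.app i ≫ p.isColimit.desc c = t i := p.isColimit.fac c i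
  refine ⟨p.isColimit.desc c, ?_, ?_⟩
  · intro Y f hf
    change p.isColimit.desc c ≫ P.map f.op = (show E ⟶ P.obj (op Y) from x f hf)
    refine p.isColimit.hom_ext fun i => ?_
    change p.ι.app i ≫ _ = p.ι.app i ≫ _
    rw [← Category.assoc, hc]
    exact ht' i f hf
  · intro y hy
    refine p.isColimit.hom_ext fun i => ?_
    change p.ι.app i ≫ (show E ⟶ P.obj (op X) from y) = p.ι.app i ≫ _
    rw [hc]
    refine htu i _ ?_
    intro Y f hf
    change (p.ι.app i ≫ (show E ⟶ P.obj (op X) from y)) ≫ P.map f.op =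
      p.ι.app i ≫ (show E ⟶ P.obj (op Y) from x f hf)
    rw [Category.assoc]
    exact congr(p.ι.app i ≫ $(hy f hf))

/-- For finitely presented `K`, the functor `Hom(K, -)` preserves limits and filtered colimits, so
it commutes with the plus construction. This reduces the claim to sheafification of presheaves of
sets. -/
theorem sheafify_isSheaf_of_isLocallyFinitelyPresentable
    [IsLocallyFinitelyPresentable.{v} ℬ] [HasLimits ℬ] {C : Type v}
    [SmallCategory C] (J : GrothendieckTopology C) (P : Cᵒᵖ ⥤ ℬ) :
    Presheaf.IsSheaf J (J.sheafify P) := by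
  refine isSheaf_of_isFinitelyPresentable J _ fun K hK => ?_
  have h := GrothendieckTopology.sheafify_isSheaf J (P ⋙ coyoneda.obj (op K))
  have e := J.sheafifyCompIso (coyoneda.obj (op K)) P
  rw [← isSheaf_iff_isSheaf_of_type]
  exact Presheaf.isSheaf_of_iso_iff e |>.2 h

/-- Used with `T` a set of presentations. It takes a relation instead of a function because an
object has no preferred presentation. -/
theorem essentiallySmall_of_relation {C : Type*} [Category* C] [LocallySmall.{v} C]
    {T : Type v} (R : T → C → Prop) (h : ∀ c, ∃ t, R t c)
    (h' : ∀ t c c', R t c → R t c' → Nonempty (c ≅ c')) : EssentiallySmall.{v} C := by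
  rw [essentiallySmall_iff]
  choose f hf using h
  refine ⟨small_of_injective (f := fun x : Skeleton C => f x.out) fun x y e => ?_, inferInstance⟩
  obtain ⟨i⟩ := h' _ _ _ (hf _) ((congrArg (fun t => R t y.out) e).mpr (hf _))
  exact Quotient.out_equiv_out.1 ⟨i⟩

end LocallyFinitelyPresentable

end

section

variable {𝒜 : Type u'} [Category.{v'} 𝒜] {ℬ : Type u} [Category.{v} ℬ] {U : 𝒜 ⥤ ℬ}

/-! ### Diagonally universal morphisms of finite presentation -/

theorem IsDiagUniversal.of_isPushout {K K' B C : ℬ} {l : K ⟶ K'} {a : K ⟶ B} {n : B ⟶ C}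
    {b : K' ⟶ C} (hl : IsDiagUniversal U l) (h : IsPushout a l n b) : IsDiagUniversal U n := by
  intro A A' f s t hst
  obtain ⟨d, ⟨hd₁, hd₂⟩, hu⟩ := hl f (a ≫ s) (b ≫ t) (by
    rw [Category.assoc, hst, ← Category.assoc, h.w, Category.assoc])
  refine ⟨h.desc s d hd₁.symm, ⟨h.inl_desc _ _ _, h.hom_ext ?_ ?_⟩, ?_⟩
  · rw [h.inl_desc_assoc, hst]
  · rw [h.inr_desc_assoc, hd₂]
  · rintro e ⟨he₁, he₂⟩
    refine h.hom_ext ?_ ?_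
    · rw [h.inl_desc, he₁]
    · rw [h.inr_desc]
      refine hu _ ⟨?_, ?_⟩
      · rw [← Category.assoc, ← h.w, Category.assoc, he₁]
      · rw [Category.assoc, he₂]

theorem IsBasic.isDiagUniversal {B C : ℬ} {n : B ⟶ C} (hn : IsBasic U n) :
    IsDiagUniversal U n := by
  obtain ⟨K, K', l, a, b, -, -, hl, h⟩ := hn
  exact hl.of_isPushout h

theorem IsBasic.of_isPushout {B C B' C' : ℬ} {n : B ⟶ C} {f : B ⟶ B'} {m : B' ⟶ C'} {g : C ⟶ C'}
    (hn : IsBasic U n) (h : IsPushout f n m g) : IsBasic U m := by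
  obtain ⟨K, K', l, a, b, hK, hK', hl, h'⟩ := hn
  exact ⟨K, K', l, a ≫ f, b ≫ g, hK, hK', hl, h'.flip.paste_vert h.flip |>.flip⟩

theorem IsDiagUniversal.isBasic {K K' : ℬ} {l : K ⟶ K'} (hl : IsDiagUniversal U l)
    (hK : IsFinitelyPresentable.{v} K) (hK' : IsFinitelyPresentable.{v} K') : IsBasic U l :=
  ⟨K, K', l, 𝟙 K, 𝟙 K', hK, hK', hl, IsPushout.of_horiz_isIso ⟨by simp⟩⟩

theorem isDiagUniversal_id (B : ℬ) : IsDiagUniversal U (𝟙 B) := by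
  intro A A' f a c h
  refine ⟨a, ⟨Category.id_comp _, by simpa using h⟩, ?_⟩
  rintro d ⟨hd, -⟩
  simpa using hd

/-- `B` itself need not be finitely presented, so the identity is obtained as a pushout of the
identity of the initial object. -/
theorem isBasic_id [HasColimits ℬ] (B : ℬ) : IsBasic U (𝟙 B) :=
  ((isDiagUniversal_id (⊥_ ℬ)).isBasic initial_isFinitelyPresentable
    initial_isFinitelyPresentable).of_isPushout
    (f := initial.to B) (g := initial.to B) (IsPushout.of_vert_isIso ⟨by simp⟩)

theorem IsDiagUniversal.coprod_map [HasColimits ℬ] {K₁ K₁' K₂ K₂' : ℬ} {l₁ : K₁ ⟶ K₁'}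
    {l₂ : K₂ ⟶ K₂'} (h₁ : IsDiagUniversal U l₁) (h₂ : IsDiagUniversal U l₂) :
    IsDiagUniversal U (coprod.map l₁ l₂) := by
  intro A A' f a c h
  obtain ⟨d₁, ⟨h₁₁, h₁₂⟩, hu₁⟩ := h₁ f (coprod.inl ≫ a) (coprod.inl ≫ c) (by
    rw [Category.assoc, h, coprod.inl_map_assoc])
  obtain ⟨d₂, ⟨h₂₁, h₂₂⟩, hu₂⟩ := h₂ f (coprod.inr ≫ a) (coprod.inr ≫ c) (by
    rw [Category.assoc, h, coprod.inr_map_assoc])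
  refine ⟨coprod.desc d₁ d₂, ⟨?_, ?_⟩, ?_⟩
  · ext
    · rw [coprod.inl_map_assoc, coprod.inl_desc, h₁₁]
    · rw [coprod.inr_map_assoc, coprod.inr_desc, h₂₁]
  · ext
    · rw [coprod.inl_desc_assoc, h₁₂]
    · rw [coprod.inr_desc_assoc, h₂₂]
  · rintro d ⟨hd, hd'⟩
    ext
    · rw [coprod.inl_desc]
      exact hu₁ _ ⟨by rw [← hd, coprod.inl_map_assoc], by rw [Category.assoc, hd']⟩
    · rw [coprod.inr_desc]
      exact hu₂ _ ⟨by rw [← hd, coprod.inr_map_assoc], by rw [Category.assoc, hd']⟩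

/-- The join of two basic morphisms under `B` is basic. -/
theorem IsBasic.join [HasColimits ℬ] {B C₁ C₂ C : ℬ} {n₁ : B ⟶ C₁} {n₂ : B ⟶ C₂} {i : C₁ ⟶ C}
    {j : C₂ ⟶ C} (h₁ : IsBasic U n₁) (h₂ : IsBasic U n₂) (h : IsPushout n₁ n₂ i j) :
    IsBasic U (n₁ ≫ i) := by
  obtain ⟨K₁, K₁', l₁, a₁, b₁, hK₁, hK₁', hl₁, p₁⟩ := h₁
  obtain ⟨K₂, K₂', l₂, a₂, b₂, hK₂, hK₂', hl₂, p₂⟩ := h₂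
  -- Pushing out along `l₁` and `l₂` simultaneously is pushing out along their coproduct, which is
  -- again diagonally universal between finitely presented objects.
  refine ⟨K₁ ⨿ K₂, K₁' ⨿ K₂', coprod.map l₁ l₂, coprod.desc a₁ a₂,
    coprod.desc (b₁ ≫ i) (b₂ ≫ j), coprod_isFinitelyPresentable _ _ hK₁ hK₂,
    coprod_isFinitelyPresentable _ _ hK₁' hK₂', hl₁.coprod_map hl₂, ?_⟩
  have w : coprod.desc a₁ a₂ ≫ n₁ ≫ i = coprod.map l₁ l₂ ≫ coprod.desc (b₁ ≫ i) (b₂ ≫ j) := by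
    ext
    · rw [coprod.inl_desc_assoc, coprod.inl_map_assoc, coprod.inl_desc, p₁.w_assoc]
    · rw [coprod.inr_desc_assoc, coprod.inr_map_assoc, coprod.inr_desc, h.w, p₂.w_assoc]
  refine ⟨⟨w⟩, ⟨PushoutCocone.IsColimit.mk w
    (fun s => h.desc (p₁.desc s.inl (coprod.inl ≫ s.inr) ?_)
      (p₂.desc s.inl (coprod.inr ≫ s.inr) ?_) ?_) ?_ ?_ ?_⟩⟩
  · rw [← coprod.inl_desc_assoc a₁ a₂, s.condition, coprod.inl_map_assoc]
  · rw [← coprod.inr_desc_assoc a₁ a₂, s.condition, coprod.inr_map_assoc]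
  · rw [p₁.inl_desc, p₂.inl_desc]
  · intro s
    rw [Category.assoc, h.inl_desc, p₁.inl_desc]
  · intro s
    ext
    · rw [coprod.inl_desc_assoc, Category.assoc, h.inl_desc, p₁.inr_desc]
    · rw [coprod.inr_desc_assoc, Category.assoc, h.inr_desc, p₂.inr_desc]
  · intro s m hm₁ hm₂
    have e₁ : b₁ ≫ i ≫ m = coprod.inl ≫ s.inr := by
      rw [← hm₂, coprod.inl_desc_assoc, Category.assoc]
    have e₂ : b₂ ≫ j ≫ m = coprod.inr ≫ s.inr := by
      rw [← hm₂, coprod.inr_desc_assoc, Category.assoc]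
    refine h.hom_ext ?_ ?_
    · rw [h.inl_desc]
      exact p₁.hom_ext (by rw [p₁.inl_desc, ← hm₁, Category.assoc]) (by rw [p₁.inr_desc, e₁])
    · rw [h.inr_desc]
      exact p₂.hom_ext (by rw [p₂.inl_desc, ← hm₁, Category.assoc, h.w_assoc]) (by rw [p₂.inr_desc, e₂])

/-! ### Local units -/

namespace LocalUnits

variable (L : LocalUnits U) {B : ℬ} {A : 𝒜}

theorem eq_of_fac {f : B ⟶ U.obj A} (ξ : L.Idx B) (h : L.obj ξ ⟶ A)
    (e : L.unit ξ ≫ U.map h = f) :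
    (⟨ξ, h⟩ : Σ ξ : L.Idx B, (L.obj ξ ⟶ A)) = ⟨L.idx f, L.lift f⟩ :=
  (L.existsUnique_fac f).unique e (L.fac f)

/-- A morphism to some `U A` factors through a diagonally universal morphism as soon as its local
unit does, and conversely. -/
theorem exists_fac_iff {C : ℬ} {n : B ⟶ C} (hn : IsDiagUniversal U n) (f : B ⟶ U.obj A) :
    (∃ g : C ⟶ U.obj (L.obj (L.idx f)), n ≫ g = L.unit (L.idx f)) ↔
      ∃ g : C ⟶ U.obj A, n ≫ g = f := by
  constructor
  · rintro ⟨g, hg⟩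
    exact ⟨g ≫ U.map (L.lift f), by rw [← Category.assoc, hg, L.fac]⟩
  · rintro ⟨g, hg⟩
    obtain ⟨d, ⟨hd, -⟩, -⟩ := hn (L.lift f) (L.unit (L.idx f)) g (by rw [L.fac, hg])
    exact ⟨d, hd⟩

end LocalUnits

/-! ### Consequences of Diers' condition -/

/-- The presentations of basic morphisms under `B`, by a set of finitely presented objects. -/
def BasicPresentation [IsLocallyFinitelyPresentable.{v} ℬ] (B : ℬ) : Type v :=
  let P := ObjectProperty.isFinitelyPresentable.{v} ℬ
  let A : SmallModel.{v} P.FullSubcategory ⥤ ℬ := (equivSmallModel.{v} P.FullSubcategory).inverse ⋙ P.ι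
  Σ (K K' : SmallModel.{v} P.FullSubcategory), (A.obj K ⟶ A.obj K') × (A.obj K ⟶ B)

/-- A morphism `n` has a given presentation. -/
def BasicPresentation.Presents [IsLocallyFinitelyPresentable.{v} ℬ] {B C : ℬ}
    (t : BasicPresentation B) (n : B ⟶ C) : Prop :=
  ∃ b, IsPushout t.2.2.2 t.2.2.1 n b

theorem IsBasic.exists_presents [IsLocallyFinitelyPresentable.{v} ℬ] {B C : ℬ} {n : B ⟶ C}
    (hn : IsBasic U n) : ∃ t : BasicPresentation B, t.Presents n := by
  obtain ⟨K, K', l, a, b, hK, hK', -, h⟩ := hn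
  let P := ObjectProperty.isFinitelyPresentable.{v} ℬ
  let e := equivSmallModel.{v} P.FullSubcategory
  let i (K : ℬ) (hK : P K) : (e.inverse ⋙ P.ι).obj (e.functor.obj ⟨K, hK⟩) ≅ K :=
    P.ι.mapIso (e.unitIso.app ⟨K, hK⟩).symm
  exact ⟨⟨e.functor.obj ⟨K, hK⟩, e.functor.obj ⟨K', hK'⟩,
    (i K hK).hom ≫ l ≫ (i K' hK').inv, (i K hK).hom ≫ a⟩, (i K' hK').hom ≫ b,
    h.of_iso (i K hK).symm (Iso.refl _) (i K' hK').symm (Iso.refl _) (by simp) (by simp)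
      (by simp) (by simp)⟩

theorem BasicPresentation.Presents.exists_iso [IsLocallyFinitelyPresentable.{v} ℬ] {B C C' : ℬ}
    {t : BasicPresentation B} {n : B ⟶ C} {n' : B ⟶ C'} (h : t.Presents n) (h' : t.Presents n') :
    ∃ e : C ≅ C', n ≫ e.hom = n' := by
  obtain ⟨b, h⟩ := h
  obtain ⟨b', h'⟩ := h'
  exact ⟨h.isoIsPushout _ _ h', h.inl_isoIsPushout_hom _ _ h'⟩

/-- Finite presentability only speaks of small filtered colimits, whereas `V_ξ` lives in the
universe of `ℬ`; a small model is needed before `DiersCondition` can be tested on finitely presented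
objects. -/
theorem essentiallySmall_below [IsLocallyFinitelyPresentable.{v} ℬ] (L : LocalUnits U) {B : ℬ}
    (ξ : L.Idx B) : EssentiallySmall.{v} (below L ξ).FullSubcategory := by
  refine essentiallySmall_of_relation (T := BasicPresentation B)
    (fun t n => t.Presents n.obj.hom) (fun n => n.property.1.exists_presents) ?_
  intro t n n' h h'
  obtain ⟨e, he⟩ := h.exists_iso h'
  exact ⟨ObjectProperty.isoMk _ (Under.isoMk e he)⟩

section

variable {L : LocalUnits U} (hL : DiersCondition L) {B : ℬ} (ξ : L.Idx B)

/-- The canonical cocone of Diers' condition. -/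
def DiersCondition.ι : (below L ξ).ι ⟶ (Functor.const _).obj (Under.mk (L.unit ξ)) :=
  (hL B ξ).2.choose

/-- The local unit `ξ` is the colimit of `V_ξ`. -/
def DiersCondition.isColimit : IsColimit (Cocone.mk _ (hL.ι ξ)) :=
  (hL B ξ).2.choose_spec.some

theorem DiersCondition.unit_ι (n : (below L ξ).FullSubcategory) :
    n.obj.hom ≫ ((hL.ι ξ).app n).right = L.unit ξ :=
  Under.w ((hL.ι ξ).app n)

theorem DiersCondition.w {n m : (below L ξ).FullSubcategory} (f : n ⟶ m) :
    f.hom.right ≫ ((hL.ι ξ).app m).right = ((hL.ι ξ).app n).right := by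
  have := congr($((hL.ι ξ).naturality f).right)
  simpa using this

/-- The object `U (A_ξ)` is the colimit of the codomains of the `n ∈ V_ξ`. -/
def DiersCondition.isColimitForget :
    IsColimit ((Under.forget B).mapCocone (Cocone.mk _ (hL.ι ξ))) :=
  haveI := (hL B ξ).1
  isColimitOfPreserves (Under.forget B) (hL.isColimit ξ)

variable [IsLocallyFinitelyPresentable.{v} ℬ] {K : ℬ}

theorem DiersCondition.exists_hom (hK : IsFinitelyPresentable.{v} K) (f : K ⟶ U.obj (L.obj ξ)) :
    ∃ (n : (below L ξ).FullSubcategory) (g : K ⟶ n.obj.right),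
      g ≫ ((hL.ι ξ).app n).right = f := by
  have := (hL B ξ).1
  have := essentiallySmall_below L ξ
  let e := equivSmallModel.{v} (below L ξ).FullSubcategory
  have := IsFiltered.of_equivalence e
  obtain ⟨j, g, hg⟩ := IsFinitelyPresentable.exists_hom_of_isColimit
    ((Functor.Final.isColimitWhiskerEquiv e.inverse _).symm (hL.isColimitForget ξ)) f
  exact ⟨_, g, hg⟩

theorem DiersCondition.exists_eq (hK : IsFinitelyPresentable.{v} K)
    {n m : (below L ξ).FullSubcategory} (f : K ⟶ n.obj.right)
    (g : K ⟶ m.obj.right)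
    (h : f ≫ ((hL.ι ξ).app n).right = g ≫ ((hL.ι ξ).app m).right) :
    ∃ (k : (below L ξ).FullSubcategory) (u : n ⟶ k) (v : m ⟶ k),
      f ≫ u.hom.right = g ≫ v.hom.right := by
  have := (hL B ξ).1
  have := essentiallySmall_below L ξ
  let e := equivSmallModel.{v} (below L ξ).FullSubcategory
  have := IsFiltered.of_equivalence e
  let c := ((Under.forget B).mapCocone (Cocone.mk _ (hL.ι ξ))).whisker e.inverse
  have hc : IsColimit c :=
    (Functor.Final.isColimitWhiskerEquiv e.inverse _).symm (hL.isColimitForget ξ)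
  let a := e.unitIso.hom.app n
  let b := e.unitIso.hom.app m
  obtain ⟨k, u, v, h⟩ := IsFinitelyPresentable.exists_eq_of_isColimit hc
    (i := e.functor.obj n) (j := e.functor.obj m) (f ≫ a.hom.right) (g ≫ b.hom.right) (by
      have ha := hL.w ξ a
      have hb := hL.w ξ b
      change (f ≫ a.hom.right) ≫ ((hL.ι ξ).app _).right = (g ≫ b.hom.right) ≫ ((hL.ι ξ).app _).right
      rw [Category.assoc, Category.assoc]
      exact (congrArg (f ≫ ·) ha).trans (h.trans (congrArg (g ≫ ·) hb).symm))
  refine ⟨e.inverse.obj k, a ≫ e.inverse.map u, b ≫ e.inverse.map v, ?_⟩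
  simpa using! h

/-- The factorization of a local unit `ξ` through some `n ∈ V_ξ` is unique. -/
theorem DiersCondition.eq_ι (n : (below L ξ).FullSubcategory) (g : n.obj.right ⟶ U.obj (L.obj ξ))
    (hg : n.obj.hom ≫ g = L.unit ξ) : g = ((hL.ι ξ).app n).right := by
  obtain ⟨K, K', l, a, b, hK, hK', hl, h⟩ := n.property.1
  -- The part of `g` on `K'` lifts to some `m ∈ V_ξ`, and after moving to some `k` the lift is
  -- compatible with `l`. It thus induces a morphism `f : n ⟶ k` of `V_ξ`, and `g` is `f` followed
  -- by the cocone leg at `k`.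
  obtain ⟨m, t, ht⟩ := hL.exists_hom ξ hK' (b ≫ g)
  obtain ⟨k, u, w, e⟩ := hL.exists_eq ξ hK (n := m) (m := m) (l ≫ t) (a ≫ m.obj.hom) (by
    rw [Category.assoc, ht, Category.assoc, hL.unit_ι, ← hg, h.w_assoc])
  have e' : a ≫ k.obj.hom = l ≫ t ≫ u.hom.right := by
    rw [← Category.assoc, e, Category.assoc, Under.w w.hom]
  let f : n ⟶ k := ObjectProperty.homMk (Under.homMk (h.desc _ _ e') (h.inl_desc _ _ _))
  rw [← hL.w ξ f]
  refine h.hom_ext ?_ ?_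
  · rw [hg, hL.w ξ f, hL.unit_ι]
  · change b ≫ g = b ≫ h.desc _ _ e' ≫ _
    rw [h.inr_desc_assoc, Category.assoc, hL.w, ht]

end

/-- Basic morphisms are epimorphic with respect to the objects `U A`. -/
theorem IsBasic.hom_ext [IsLocallyFinitelyPresentable.{v} ℬ] {L : LocalUnits U}
    (hL : DiersCondition L) {B C : ℬ} {n : B ⟶ C} (hn : IsBasic U n) {A : 𝒜} {g g' : C ⟶ U.obj A}
    (h : n ≫ g = n ≫ g') : g = g' := by
  have hlift := L.fac (n ≫ g)
  -- Orthogonality to `U (L.lift _)` replaces `g` and `g'` by two factorizations through `n` of the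
  -- same local unit, which `DiersCondition.eq_ι` identifies.
  obtain ⟨d, ⟨hd, hd'⟩, -⟩ := hn.isDiagUniversal (L.lift (n ≫ g)) (L.unit _) g hlift
  obtain ⟨e, ⟨he, he'⟩, -⟩ := hn.isDiagUniversal (L.lift (n ≫ g)) (L.unit _) g' (hlift.trans h)
  let m : (below L (L.idx (n ≫ g))).FullSubcategory := ⟨Under.mk n, hn, d, hd⟩
  rw [← hd', ← he', hL.eq_ι _ m d hd, hL.eq_ι _ m e he]

end

section

variable {𝒜 : Type u'} [Category.{v'} 𝒜] {ℬ : Type u} [Category.{v} ℬ] {U : 𝒜 ⥤ ℬ}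

/-! ### Germs of morphisms from finitely presented objects -/

theorem res_res {X : TopCat.{v}} (F : TopCat.Presheaf ℬ X) {V W N : Opens X} (i : N ≤ W)
    (j : W ≤ V) :
    F.map (homOfLE j).op ≫ F.map (homOfLE i).op = F.map (homOfLE (i.trans j)).op := by
  rw [← F.map_comp]
  rfl

section Germs

variable [HasColimits ℬ] {X : TopCat.{v}} {F : TopCat.Presheaf ℬ X} {K : ℬ}

variable (F) in
theorem exists_germ_eq (hK : IsFinitelyPresentable.{v} K) {x : X} (f : K ⟶ F.stalk x) :
    ∃ (V : Opens X) (hx : x ∈ V) (g : K ⟶ F.obj (op V)), g ≫ F.germ V x hx = f := by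
  obtain ⟨V, g, hg⟩ := IsFinitelyPresentable.exists_hom_of_isColimit
    (colimit.isColimit ((OpenNhds.inclusion x).op ⋙ F)) (f : K ⟶ _)
  exact ⟨V.unop.1, V.unop.2, g, hg⟩

variable (F) in
theorem exists_res_eq_of_germ_eq (hK : IsFinitelyPresentable.{v} K) {x : X} {V W : Opens X}
    (hV : x ∈ V) (hW : x ∈ W) (f : K ⟶ F.obj (op V)) (g : K ⟶ F.obj (op W))
    (h : f ≫ F.germ V x hV = g ≫ F.germ W x hW) :
    ∃ (N : Opens X) (_ : x ∈ N) (i : N ≤ V) (j : N ≤ W),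
      f ≫ F.map (homOfLE i).op = g ≫ F.map (homOfLE j).op := by
  obtain ⟨N, a, b, e⟩ := IsFinitelyPresentable.exists_eq_of_isColimit
    (colimit.isColimit ((OpenNhds.inclusion x).op ⋙ F))
    (i := op ⟨V, hV⟩) (j := op ⟨W, hW⟩) f g h
  exact ⟨N.unop.1, N.unop.2, leOfHom ((OpenNhds.inclusion x).map a.unop),
    leOfHom ((OpenNhds.inclusion x).map b.unop), e⟩

/-- The covering sieve of the opens on which a local condition holds. -/
def coverOf (V : Opens X) (P : ∀ N : Opens X, N ≤ V → Prop)
    (hP : ∀ {N M : Opens X} (i : N ≤ M) (j : M ≤ V), P M j → P N (i.trans j))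
    (h : ∀ x ∈ V, ∃ (N : Opens X) (j : N ≤ V), x ∈ N ∧ P N j) :
    (Opens.grothendieckTopology X).Cover V :=
  ⟨{ arrows := fun N j => P N (leOfHom j)
     downward_closed := fun hM g => hP (leOfHom g) _ hM }, fun x hx => by
      obtain ⟨N, hNV, hN, hPN⟩ := h x hx
      exact ⟨N, homOfLE hNV, hPN, hN⟩⟩

theorem hom_ext_of_germ (hF : F.IsSheaf) (hK : IsFinitelyPresentable.{v} K) {V : Opens X}
    {f g : K ⟶ F.obj (op V)}
    (h : ∀ (x : X) (hx : x ∈ V), f ≫ F.germ V x hx = g ≫ F.germ V x hx) : f = g := by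
  refine Presheaf.IsSheaf.hom_ext hF (coverOf V
    (fun N hN => f ≫ F.map (homOfLE hN).op = g ≫ F.map (homOfLE hN).op) ?_ ?_) _ _ ?_
  · intro N M i j hM
    rw [← res_res F i j, ← Category.assoc, hM, Category.assoc]
  · intro x hx
    obtain ⟨N, hxN, i, j, e⟩ := exists_res_eq_of_germ_eq F hK hx hx f g (h x hx)
    exact ⟨N, i, hxN, e⟩
  · rintro ⟨N, i, hi⟩
    exact hi

end Germs

/-! ### Sections of sheaves with stalks in the image of `U` -/

section Sections

variable [IsLocallyFinitelyPresentable.{v} ℬ] {X : TopCat.{v}} {F : TopCat.Presheaf ℬ X}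
  {loc : X → 𝒜} {B C : ℬ} {n : B ⟶ C}

/-- By the pushout it suffices to compare on the finitely presented `K'`, hence on germs. There the
stalks are of the form `U A`, and `IsBasic.hom_ext` applies to `l : K ⟶ K'`. -/
theorem IsBasic.hom_ext_sections {L : LocalUnits U} (hL : DiersCondition L) (hn : IsBasic U n)
    (e : ∀ x, F.stalk x ≅ U.obj (loc x)) (hF : F.IsSheaf) {W : Opens X}
    {γ γ' : C ⟶ F.obj (op W)} (h : n ≫ γ = n ≫ γ') : γ = γ' := by
  obtain ⟨K, K', l, a, b, hK, hK', hl, p⟩ := hn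
  refine p.hom_ext h (hom_ext_of_germ hF hK' fun x hx => ?_)
  rw [← cancel_mono (e x).hom]
  refine (hl.isBasic hK hK').hom_ext hL ?_
  simp only [Category.assoc]
  rw [← p.w_assoc, ← p.w_assoc, reassoc_of% h]

/-- A factorization through a basic morphism at a stalk extends to a neighbourhood. -/
theorem IsBasic.exists_local_factorization (hn : IsBasic U n)
    (e : ∀ x, F.stalk x ≅ U.obj (loc x)) {V : Opens X} (β : B ⟶ F.obj (op V)) {x : X}
    (hx : x ∈ V) (g : C ⟶ U.obj (loc x)) (hg : n ≫ g = β ≫ F.germ V x hx ≫ (e x).hom) :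
    ∃ (N : Opens X) (_ : x ∈ N) (i : N ≤ V) (γ : C ⟶ F.obj (op N)),
      n ≫ γ = β ≫ F.map (homOfLE i).op := by
  obtain ⟨K, K', l, a, b, hK, hK', hl, p⟩ := hn
  -- `K'` finitely presented gives a representative of the factorization near `x`; `K` finitely
  -- presented makes it compatible with `β` on a smaller neighbourhood.
  obtain ⟨W, hxW, s, hs⟩ := exists_germ_eq F hK' (b ≫ g ≫ (e x).inv)
  obtain ⟨N, hxN, i, j, h⟩ := exists_res_eq_of_germ_eq F hK hx hxW (a ≫ β) (l ≫ s) (by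
    rw [Category.assoc, Category.assoc, hs, ← p.w_assoc, reassoc_of% hg, Iso.hom_inv_id,
      Category.comp_id])
  rw [Category.assoc, Category.assoc] at h
  exact ⟨N, hxN, i, p.desc _ _ h, p.inl_desc _ _ _⟩

theorem IsBasic.isOpen_setOf_factorization (hn : IsBasic U n)
    (e : ∀ x, F.stalk x ≅ U.obj (loc x)) {V : Opens X} (β : B ⟶ F.obj (op V)) :
    IsOpen {x | ∃ (hx : x ∈ V) (g : C ⟶ U.obj (loc x)),
      n ≫ g = β ≫ F.germ V x hx ≫ (e x).hom} := by
  rw [isOpen_iff_forall_mem_open]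
  rintro x ⟨hx, g, hg⟩
  obtain ⟨N, hxN, i, γ, hγ⟩ := hn.exists_local_factorization e β hx g hg
  refine ⟨N, fun y hy => ⟨i hy, γ ≫ F.germ N y hy ≫ (e y).hom, ?_⟩, N.isOpen, hxN⟩
  rw [reassoc_of% hγ, TopCat.Presheaf.germ_res_assoc]

/-- A morphism to the sections over `V` factors through a basic morphism over the open of the
points at which it does. -/
theorem IsBasic.exists_factorization {L : LocalUnits U} (hL : DiersCondition L)
    (hn : IsBasic U n) (e : ∀ x, F.stalk x ≅ U.obj (loc x)) (hF : F.IsSheaf) {V W : Opens X}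
    (hWV : W ≤ V) (β : B ⟶ F.obj (op V))
    (h : ∀ x (hx : x ∈ W), ∃ g : C ⟶ U.obj (loc x),
      n ≫ g = β ≫ F.germ V x (hWV hx) ≫ (e x).hom) :
    ∃ γ : C ⟶ F.obj (op W), n ≫ γ = β ≫ F.map (homOfLE hWV).op := by
  let S := coverOf W (fun N hN => ∃ γ : C ⟶ F.obj (op N),
    n ≫ γ = β ≫ F.map (homOfLE (hN.trans hWV)).op) (by
      rintro N M i j ⟨γ, hγ⟩
      exact ⟨γ ≫ F.map (homOfLE i).op, by rw [reassoc_of% hγ, res_res]⟩) (by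
      intro x hx
      obtain ⟨g, hg⟩ := h x hx
      obtain ⟨N, hxN, i, γ, hγ⟩ := hn.exists_local_factorization e β (hWV hx) g hg
      exact ⟨N ⊓ W, inf_le_right, ⟨hxN, hx⟩, γ ≫ F.map (homOfLE inf_le_left).op, by
        rw [reassoc_of% hγ, res_res]⟩)
  have hS (I : S.Arrow) : ∃ γ : C ⟶ F.obj (op I.Y),
    n ≫ γ = β ≫ F.map (homOfLE ((leOfHom I.f).trans hWV)).op := I.hf
  choose γ hγ using hS
  -- The local factorizations agree on overlaps because factorizations through `n` are unique.
  have hcompat ⦃I₁ I₂ : S.Arrow⦄ (r : I₁.Relation I₂) :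
      γ I₁ ≫ F.map r.g₁.op = γ I₂ ≫ F.map r.g₂.op := by
    refine hn.hom_ext_sections hL e hF ?_
    rw [reassoc_of% (hγ I₁), reassoc_of% (hγ I₂), ← F.map_comp, ← F.map_comp]
    rfl
  have hF' : Presheaf.IsSheaf (Opens.grothendieckTopology X) F := hF
  refine ⟨hF'.amalgamate S γ hcompat, hF'.hom_ext S _ _ fun I => ?_⟩
  rw [Category.assoc, hF'.amalgamate_map, hγ, Category.assoc, ← F.map_comp]
  rfl

end Sections

end

section

variable {𝒜 : Type u'} [Category.{v'} 𝒜] {ℬ : Type u} [Category.{v} ℬ] {U : 𝒜 ⥤ ℬ}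
  [HasColimits ℬ] {𝔹 : SheafedSpace.{u, v, v} ℬ}

/-! ### The basic opens of the Diers space -/

namespace BasicPair

/-- The object `(u, id)` of `𝒟_𝔹`. -/
abbrev ofOpen (U : 𝒜 ⥤ ℬ) (w : Opens 𝔹) : BasicPair U 𝔹 :=
  ⟨w, 𝔹.presheaf.obj (op w), 𝟙 _, isBasic_id _⟩

/-- The morphism `(u, id) ⟶ (u, n)` given by `n`. -/
def fromOpen (p : BasicPair U 𝔹) : ofOpen U p.u ⟶ p :=
  BasicPair.Hom.mk le_rfl p.n (by
    change 𝟙 _ ≫ p.n = 𝔹.presheaf.map (𝟙 _) ≫ p.n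
    rw [𝔹.presheaf.map_id])

/-- The morphism `(u, id) ⟶ (w, id)` given by the restriction. -/
def ofOpenMap {u w : Opens 𝔹} (h : w ≤ u) : ofOpen U u ⟶ ofOpen U w :=
  BasicPair.Hom.mk h (𝔹.presheaf.map (homOfLE h).op)
    ((Category.id_comp _).trans (Category.comp_id _).symm)

variable (p : BasicPair U 𝔹) {w : Opens 𝔹} (h : w ≤ p.u)

theorem isPushout_restrict :
    IsPushout (𝔹.presheaf.map (homOfLE h).op) p.n
      (pushout.inr p.n (𝔹.presheaf.map (homOfLE h).op)) (pushout.inl _ _) :=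
  (IsPushout.of_hasPushout _ _).flip

/-- The restriction of `(u, n)` to some `w ⊆ u`. -/
abbrev restrict : BasicPair U 𝔹 :=
  ⟨w, pushout p.n (𝔹.presheaf.map (homOfLE h).op), pushout.inr _ _,
    p.isBasic.of_isPushout (p.isPushout_restrict h)⟩

/-- The canonical morphism to the restriction. -/
def toRestrict : p ⟶ p.restrict h :=
  BasicPair.Hom.mk h (pushout.inl _ _) pushout.condition

end BasicPair

/-- The attaching morphism `K ⟶ 𝔹_x` has a finitely presented source, so it comes from sections over
some open; the pushout can be formed there first. -/
theorem exists_basicPair_of_stalk {x : 𝔹} {C : ℬ} {n : 𝔹.presheaf.stalk x ⟶ C}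
    (hn : IsBasic U n) : ∃ (p : BasicPair U 𝔹) (hx : x ∈ p.u) (t : p.cod ⟶ C),
      IsPushout (𝔹.presheaf.germ p.u x hx) p.n n t := by
  obtain ⟨K, K', l, a, b, hK, hK', hl, h⟩ := hn
  obtain ⟨V, hx, a', rfl⟩ := exists_germ_eq 𝔹.presheaf hK a
  have hp : IsPushout a' l (pushout.inl a' l) (pushout.inr a' l) := IsPushout.of_hasPushout _ _
  have e : a' ≫ 𝔹.presheaf.germ V x hx ≫ n = l ≫ b := by
    rw [← Category.assoc, h.w]
  refine ⟨⟨V, _, pushout.inl a' l, K, K', l, a', _, hK, hK', hl, hp⟩, hx, pushout.desc _ _ e, ?_⟩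
  refine IsPushout.of_left ?_ ?_ hp
  · rwa [pushout.inr_desc]
  · rw [pushout.inl_desc]

variable (L : LocalUnits U)

theorem mem_basicSet_ofOpen {w : Opens 𝔹} {y : Point L 𝔹} :
    y ∈ basicSet L (BasicPair.ofOpen U w) ↔ y.1 ∈ w :=
  ⟨fun h => h.1, fun h => ⟨h, _, Category.id_comp _⟩⟩

theorem mem_basicSet_restrict {p : BasicPair U 𝔹} {w : Opens 𝔹} (h : w ≤ p.u) {y : Point L 𝔹} :
    y ∈ basicSet L (p.restrict h) ↔ y ∈ basicSet L p ∧ y.1 ∈ w := by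
  constructor
  · intro hy
    exact ⟨basicOpen_anti L (p.toRestrict h) hy, hy.1⟩
  · rintro ⟨⟨hx, g, hg⟩, hw⟩
    refine ⟨hw, (p.isPushout_restrict h).desc (𝔹.presheaf.germ w y.1 hw ≫ L.unit y.2) g ?_,
      (p.isPushout_restrict h).inl_desc _ _ _⟩
    rw [hg, TopCat.Presheaf.germ_res_assoc]

theorem isTopologicalBasis_basicSet :
    IsTopologicalBasis (Set.range (basicSet L : BasicPair U 𝔹 → Set (Point L 𝔹))) where
  exists_subset_inter := by
    rintro _ ⟨p, rfl⟩ _ ⟨q, rfl⟩ y ⟨hp, hq⟩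
    have hp' := (mem_basicSet_restrict L (inf_le_left : p.u ⊓ q.u ≤ p.u)).2 ⟨hp, hp.1, hq.1⟩
    have hq' := (mem_basicSet_restrict L (inf_le_right : p.u ⊓ q.u ≤ q.u)).2 ⟨hq, hp.1, hq.1⟩
    let p' := p.restrict (inf_le_left : p.u ⊓ q.u ≤ p.u)
    let q' := q.restrict (inf_le_right : p.u ⊓ q.u ≤ q.u)
    have hr := IsPushout.of_hasPushout p'.n q'.n
    -- Factoring through the join of the two restrictions amounts to factoring through both of them.
    let r : BasicPair U 𝔹 := ⟨p.u ⊓ q.u, _, p'.n ≫ pushout.inl p'.n q'.n, p'.isBasic.join q'.isBasic hr⟩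
    refine ⟨_, ⟨r, rfl⟩, ?_, ?_⟩
    · obtain ⟨hx, g, hg⟩ := hp'
      obtain ⟨_, g', hg'⟩ := hq'
      have e : p'.n ≫ g = q'.n ≫ g' := hg.trans hg'.symm
      exact ⟨hx, hr.desc g g' e, (Category.assoc _ _ _).trans
        ((congrArg (p'.n ≫ ·) (hr.inl_desc g g' e)).trans hg)⟩
    · rintro z ⟨hx, g, hg⟩
      have e : p'.n ≫ pushout.inl p'.n q'.n ≫ g = q'.n ≫ pushout.inr p'.n q'.n ≫ g :=
        hr.w_assoc g
      have e' := (Category.assoc _ _ _).symm.trans hg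
      exact ⟨((mem_basicSet_restrict L _).1 ⟨hx, pushout.inl p'.n q'.n ≫ g, e'⟩).1,
        ((mem_basicSet_restrict L _).1 ⟨hx, pushout.inr p'.n q'.n ≫ g, e.symm.trans e'⟩).1⟩
  sUnion_eq := Set.eq_univ_of_forall fun y =>
    ⟨_, ⟨BasicPair.ofOpen U ⊤, rfl⟩, (mem_basicSet_ofOpen L).2 trivial⟩
  eq_generateFrom := rfl

/-- The generating sets match: the trace of `D_(u,n)` on the fibre is given by the pushout of `n` to
the stalk, or is empty if `x ∉ u`, and `exists_basicPair_of_stalk` shows that every generator of the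
spectral topology is such a trace. -/
theorem isEmbedding_stalkInclusion (x : 𝔹) :
    @Topology.IsEmbedding _ _ (spectralTopology L (𝔹.presheaf.stalk x)) _
      (stalkInclusion L 𝔹 x) := by
  let _ := spectralTopology L (𝔹.presheaf.stalk x)
  refine ⟨⟨?_⟩, fun ξ ξ' h => eq_of_heq (Sigma.mk.inj h).2⟩
  refine Eq.trans ?_ induced_generateFrom_eq.symm
  refine le_antisymm (le_generateFrom ?_) (le_generateFrom ?_)
  · rintro _ ⟨_, ⟨p, rfl⟩, rfl⟩
    by_cases hx : x ∈ p.u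
    · refine isOpen_generateFrom_of_mem ⟨Under.mk (pushout.inr p.n (𝔹.presheaf.germ p.u x hx)),
        p.isBasic.of_isPushout (IsPushout.of_hasPushout _ _).flip, ?_⟩
      ext ξ
      refine (mem_basicSet_iff L p ⟨x, ξ⟩).trans ⟨fun ⟨_, h⟩ => h, fun h => ⟨hx, h⟩⟩
    · convert! isOpen_empty
      ext ξ
      exact ⟨fun h => hx h.1, fun h => h.elim⟩
  · rintro _ ⟨n, hn, rfl⟩
    obtain ⟨p, hx, t, h⟩ := exists_basicPair_of_stalk hn
    refine isOpen_generateFrom_of_mem ⟨_, ⟨p, rfl⟩, ?_⟩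
    ext ξ
    constructor
    · rintro ⟨_, g, hg⟩
      exact ⟨h.desc _ _ hg.symm, h.inl_desc _ _ _⟩
    · rintro ⟨g, hg⟩
      exact ⟨hx, t ≫ g, (h.w_assoc g).symm.trans (congrArg (_ ≫ ·) hg)⟩

end

section

/-! ### Pushouts of filtered colimits -/

section FilteredPushout

variable {ℬ : Type u} [Category.{v} ℬ] [HasColimits ℬ] {J : Type v} [SmallCategory J]
  {D : J ⥤ ℬ} {c : Cocone D} {j : J} {Q C : ℬ} {q : D.obj j ⟶ Q} {n : c.pt ⟶ C} {t : Q ⟶ C}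

variable (D q) in
/-- The pushouts of `q` along the transition morphisms of `D`. -/
abbrev underPushout : Under j ⥤ ℬ where
  obj k := pushout q (D.map k.hom)
  map {k l} f := pushout.desc (pushout.inl _ _) (D.map f.right ≫ pushout.inr _ _) (by
    rw [← Category.assoc, ← D.map_comp, Under.w f, pushout.condition])
  map_id k := by
    apply pushout.hom_ext
    · rw [pushout.inl_desc, Category.comp_id]
    · rw [pushout.inr_desc, Category.comp_id, Under.id_right, D.map_id, Category.id_comp]
  map_comp f g := by
    apply pushout.hom_ext
    · rw [pushout.inl_desc, pushout.inl_desc_assoc, pushout.inl_desc]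
    · rw [pushout.inr_desc, pushout.inr_desc_assoc, Category.assoc, pushout.inr_desc,
        Under.comp_right, D.map_comp, Category.assoc]

/-- The comparison from a pushout along a transition morphism to the pushout to the colimit. -/
abbrev underPushoutDesc (h : IsPushout (c.ι.app j) q n t) {k : J} (f : j ⟶ k) :
    pushout q (D.map f) ⟶ C :=
  pushout.desc t (c.ι.app k ≫ n) (by rw [c.w_assoc, h.w])

/-- The pushout to the colimit as a cocone. -/
abbrev underPushoutCocone (h : IsPushout (c.ι.app j) q n t) : Cocone (underPushout D q) where
  pt := C
  ι :=
    { app := fun k => underPushoutDesc h k.hom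
      naturality := fun k l f => by
        dsimp [underPushout, underPushoutDesc]
        apply pushout.hom_ext
        · rw [pushout.inl_desc_assoc, pushout.inl_desc, Category.comp_id, pushout.inl_desc]
        · rw [pushout.inr_desc_assoc, Category.assoc, pushout.inr_desc, Category.comp_id,
            pushout.inr_desc, c.w_assoc] }

variable [IsFiltered J]

/-- A pushout of a filtered colimit is a filtered colimit of pushouts. -/
def isColimitUnderPushoutCocone (hc : IsColimit c) (h : IsPushout (c.ι.app j) q n t) :
    IsColimit (underPushoutCocone h) := by
  have hc' := (Functor.Final.isColimitWhiskerEquiv (Under.forget j) c).symm hc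
  refine .ofExistsUnique fun s => ?_
  let d : Cocone (Under.forget j ⋙ D) :=
    { pt := s.pt
      ι :=
        { app := fun k => pushout.inr q (D.map k.hom) ≫ s.ι.app k
          naturality := fun k l f => by
            have := s.w f
            dsimp [underPushout] at this ⊢
            rw [Category.comp_id, ← this, pushout.inr_desc_assoc, Category.assoc] } }
  have hd (k : Under j) : c.ι.app k.right ≫ hc'.desc d = pushout.inr q (D.map k.hom) ≫ s.ι.app k :=
    hc'.fac d k
  -- On the constant part `Q` all legs agree with the leg at the initial object `𝟙 j` of `Under j`.
  have hs (k : Under j) : pushout.inl q (D.map k.hom) ≫ s.ι.app k =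
      pushout.inl q (D.map (𝟙 j)) ≫ s.ι.app (Under.mk (𝟙 j)) := by
    have := s.w (Under.homMk k.hom (by simp) : Under.mk (𝟙 j) ⟶ k)
    dsimp [underPushout] at this
    rw [← this, pushout.inl_desc_assoc]
  have e : c.ι.app j ≫ hc'.desc d = q ≫ pushout.inl q (D.map (𝟙 j)) ≫ s.ι.app (Under.mk (𝟙 j)) := by
    refine (hd (Under.mk (𝟙 j))).trans ?_
    rw [pushout.condition_assoc]
    simp
  refine ⟨h.desc _ _ e, fun k => ?_, fun m hm => h.hom_ext ?_ ?_⟩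
  · apply pushout.hom_ext
    · dsimp [underPushoutCocone, underPushoutDesc]
      rw [pushout.inl_desc_assoc, h.inr_desc]
      exact (hs k).symm
    · dsimp [underPushoutCocone, underPushoutDesc]
      rw [pushout.inr_desc_assoc, Category.assoc, h.inl_desc]
      exact hd k
  · rw [h.inl_desc]
    refine hc'.hom_ext fun k => ?_
    refine Eq.trans ?_ (hd k).symm
    rw [← hm k]
    dsimp [underPushoutCocone, underPushoutDesc]
    rw [pushout.inr_desc_assoc, Category.assoc]
  · rw [h.inr_desc, ← hm]
    dsimp [underPushoutCocone, underPushoutDesc]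
    rw [pushout.inl_desc_assoc]

theorem exists_hom_underPushout (hc : IsColimit c) (h : IsPushout (c.ι.app j) q n t) {K : ℬ}
    (hK : IsFinitelyPresentable.{v} K) (f : K ⟶ C) :
    ∃ (k : J) (i : j ⟶ k) (s : K ⟶ pushout q (D.map i)), s ≫ underPushoutDesc h i = f := by
  obtain ⟨k, s, hs⟩ := IsFinitelyPresentable.exists_hom_of_isColimit
    (isColimitUnderPushoutCocone hc h) (f : K ⟶ _)
  exact ⟨k.right, k.hom, s, hs⟩

theorem exists_eq_underPushout (hc : IsColimit c) (h : IsPushout (c.ι.app j) q n t) {K : ℬ}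
    (hK : IsFinitelyPresentable.{v} K) {k l : J} {i : j ⟶ k} {i' : j ⟶ l}
    (f : K ⟶ pushout q (D.map i)) (f' : K ⟶ pushout q (D.map i'))
    (e : f ≫ underPushoutDesc h i = f' ≫ underPushoutDesc h i') :
    ∃ (m : J) (g : j ⟶ m) (a : k ⟶ m) (b : l ⟶ m) (ha : i ≫ a = g) (hb : i' ≫ b = g),
      f ≫ (pushout.desc (pushout.inl _ _) (D.map a ≫ pushout.inr _ _) (by
        rw [← Category.assoc, ← D.map_comp, ha, pushout.condition]) :
          pushout q (D.map i) ⟶ pushout q (D.map g)) =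
      f' ≫ (pushout.desc (pushout.inl _ _) (D.map b ≫ pushout.inr _ _) (by
        rw [← Category.assoc, ← D.map_comp, hb, pushout.condition]) :
          pushout q (D.map i') ⟶ pushout q (D.map g)) := by
  obtain ⟨m, a, b, hab⟩ := IsFinitelyPresentable.exists_eq_of_isColimit
    (isColimitUnderPushoutCocone hc h) (i := Under.mk i) (j := Under.mk i') f f' e
  exact ⟨m.right, m.hom, a.right, b.right, Under.w a, Under.w b, hab⟩

end FilteredPushout

end

section

variable {𝒜 : Type u'} [Category.{v'} 𝒜] {ℬ : Type u} [Category.{v} ℬ] {U : 𝒜 ⥤ ℬ}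
  [HasColimits ℬ] {𝔹 : SheafedSpace.{u, v, v} ℬ}

/-! ### The pushout of a basic morphism to a stalk -/

namespace BasicPair

variable (p : BasicPair U 𝔹)

/-- The canonical morphism between two restrictions. -/
def restrictMap {w w' : Opens 𝔹} (h : w ≤ p.u) (h' : w' ≤ w) :
    p.restrict h ⟶ p.restrict (h'.trans h) :=
  BasicPair.Hom.mk h'
    (pushout.desc (pushout.inl _ _) (𝔹.presheaf.map (homOfLE h').op ≫ pushout.inr _ _) (by
        rw [← Category.assoc, res_res, pushout.condition]))
    (pushout.inr_desc _ _ _)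

variable {x : 𝔹} {p} {hx : x ∈ p.u} {C : ℬ} {n : 𝔹.presheaf.stalk x ⟶ C} {t : p.cod ⟶ C}
  (hp : IsPushout (𝔹.presheaf.germ p.u x hx) p.n n t)

/-- The morphism from a restriction to the pushout to a stalk. -/
def restrictDesc {w : Opens 𝔹} (h : w ≤ p.u) (hw : x ∈ w) : (p.restrict h).cod ⟶ C :=
  pushout.desc t (𝔹.presheaf.germ w x hw ≫ n) (by
    rw [TopCat.Presheaf.germ_res_assoc, hp.w])

theorem n_restrictDesc {w : Opens 𝔹} (h : w ≤ p.u) (hw : x ∈ w) :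
    (p.restrict h).n ≫ restrictDesc hp h hw = 𝔹.presheaf.germ w x hw ≫ n :=
  pushout.inr_desc _ _ _

theorem toRestrict_restrictDesc {w : Opens 𝔹} (h : w ≤ p.u) (hw : x ∈ w) :
    BasicPair.Hom.map (p.toRestrict h) ≫ restrictDesc hp h hw = t :=
  pushout.inl_desc _ _ _

theorem restrictMap_restrictDesc {w w' : Opens 𝔹} (h : w ≤ p.u) (h' : w' ≤ w) (hw : x ∈ w') :
    BasicPair.Hom.map (p.restrictMap h h') ≫ restrictDesc hp (h'.trans h) hw =
      restrictDesc hp h (h' hw) := by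
  dsimp only [restrictMap, restrictDesc]
  apply pushout.hom_ext
  · rw [pushout.inl_desc_assoc, pushout.inl_desc, pushout.inl_desc]
  · rw [pushout.inr_desc_assoc, Category.assoc, pushout.inr_desc, pushout.inr_desc,
      TopCat.Presheaf.germ_res_assoc]

theorem exists_hom_restrict {K : ℬ} (hK : IsFinitelyPresentable.{v} K) (f : K ⟶ C) :
    ∃ (w : Opens 𝔹) (hw : x ∈ w) (h : w ≤ p.u) (s : K ⟶ (p.restrict h).cod),
      s ≫ restrictDesc hp h hw = f := by
  obtain ⟨k, i, s, hs⟩ := exists_hom_underPushout (J := (OpenNhds x)ᵒᵖ)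
    (D := (OpenNhds.inclusion x).op ⋙ 𝔹.presheaf) (c := colimit.cocone _)
    (colimit.isColimit _) (j := op (⟨p.u, hx⟩ : OpenNhds x)) hp hK f
  exact ⟨k.unop.1, k.unop.2, leOfHom ((OpenNhds.inclusion x).map i.unop), s, hs⟩

theorem exists_eq_restrict {K : ℬ} (hK : IsFinitelyPresentable.{v} K) {w : Opens 𝔹}
    {h : w ≤ p.u} (hw : x ∈ w) (f f' : K ⟶ (p.restrict h).cod)
    (e : f ≫ restrictDesc hp h hw = f' ≫ restrictDesc hp h hw) :
    ∃ (w' : Opens 𝔹) (_ : x ∈ w') (h' : w' ≤ w),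
      f ≫ BasicPair.Hom.map (p.restrictMap h h') =
        f' ≫ BasicPair.Hom.map (p.restrictMap h h') := by
  obtain ⟨m, g, a, b, _, _, hab⟩ := exists_eq_underPushout (J := (OpenNhds x)ᵒᵖ)
    (D := (OpenNhds.inclusion x).op ⋙ 𝔹.presheaf) (c := colimit.cocone _)
    (colimit.isColimit _) (j := op (⟨p.u, hx⟩ : OpenNhds x)) hp hK
    (k := op (⟨w, hw⟩ : OpenNhds x)) (l := op (⟨w, hw⟩ : OpenNhds x))
    (i := Quiver.Hom.op (homOfLE (show (⟨w, hw⟩ : OpenNhds x) ≤ ⟨p.u, hx⟩ from h)))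
    (i' := Quiver.Hom.op (homOfLE (show (⟨w, hw⟩ : OpenNhds x) ≤ ⟨p.u, hx⟩ from h))) f f' e
  exact ⟨m.unop.1, m.unop.2, leOfHom ((OpenNhds.inclusion x).map a.unop), hab⟩

/-- A morphism from a basic object to the pushout of another one to a stalk is induced by a
morphism to some restriction of the latter. -/
theorem exists_hom_to_restrict {q : BasicPair U 𝔹} (hq : x ∈ q.u) (t' : q.cod ⟶ C)
    (ht' : q.n ≫ t' = 𝔹.presheaf.germ q.u x hq ≫ n) :
    ∃ (w : Opens 𝔹) (hw : x ∈ w) (h : w ≤ p.u) (r : q ⟶ p.restrict h),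
      BasicPair.Hom.map r ≫ restrictDesc hp h hw = t' := by
  obtain ⟨K, K', l, a, b, hK, hK', hl, po⟩ := q.isBasic
  -- `C` is the filtered colimit of the restrictions of `p`. The part of `t'` on `K'` reaches one of
  -- them, and it matches the part on `𝔹(q.u)` along `K` after a further shrinking to `w'`.
  obtain ⟨w, hw, h, s, hs⟩ := exists_hom_restrict hp hK' (b ≫ t')
  have h₁ : w ⊓ q.u ≤ w := inf_le_left
  have h₂ : w ⊓ q.u ≤ q.u := inf_le_right
  have hwq : x ∈ w ⊓ q.u := ⟨hw, hq⟩
  obtain ⟨w', hw', h', e⟩ := exists_eq_restrict hp hK (h := h₁.trans h) hwq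
    (l ≫ s ≫ BasicPair.Hom.map (p.restrictMap h h₁))
    (a ≫ 𝔹.presheaf.map (homOfLE h₂).op ≫ (p.restrict (h₁.trans h)).n) (by
      rw [Category.assoc, Category.assoc, restrictMap_restrictDesc, hs, Category.assoc,
        Category.assoc, n_restrictDesc, TopCat.Presheaf.germ_res_assoc, ← ht', po.w_assoc])
  have e' : a ≫ 𝔹.presheaf.map (homOfLE (h'.trans h₂)).op ≫
      (p.restrict (h'.trans (h₁.trans h))).n =
      l ≫ s ≫ BasicPair.Hom.map (p.restrictMap h h₁) ≫
        BasicPair.Hom.map (p.restrictMap (h₁.trans h) h') := by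
    rw [Category.assoc, Category.assoc, Category.assoc, Category.assoc,
      (p.restrictMap (h₁.trans h) h').w, reassoc_of% (res_res 𝔹.presheaf h' h₂)] at e
    exact e.symm
  refine ⟨w', hw', h'.trans (h₁.trans h), BasicPair.Hom.mk (h'.trans h₂) (po.desc _ _ e')
    (po.inl_desc _ _ _), po.hom_ext ?_ ?_⟩
  · rw [po.inl_desc_assoc, Category.assoc, n_restrictDesc, TopCat.Presheaf.germ_res_assoc, ht']
  · rw [po.inr_desc_assoc, Category.assoc, Category.assoc, restrictMap_restrictDesc,
      restrictMap_restrictDesc, hs]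

end BasicPair

end

section

variable {𝒜 : Type u'} [Category.{v'} 𝒜] {ℬ : Type u} [Category.{v} ℬ] {U : 𝒜 ⥤ ℬ}
  [HasColimits ℬ] {𝔹 : SheafedSpace.{u, v, v} ℬ} {L : LocalUnits U}

/-! ### Local objects as colimits of basic objects -/

/-- The morphism from a stalk induced by compatible morphisms from the sections. -/
theorem exists_stalk_desc {X : TopCat.{v}} (F : TopCat.Presheaf ℬ X) (x : X) {Z : ℬ}
    (θ : ∀ V : Opens X, x ∈ V → (F.obj (op V) ⟶ Z))
    (hθ : ∀ (V W : Opens X) (h : W ≤ V) (hW : x ∈ W),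
      F.map (homOfLE h).op ≫ θ W hW = θ V (h hW)) :
    ∃ η : F.stalk x ⟶ Z, ∀ V hV, F.germ V x hV ≫ η = θ V hV := by
  refine ⟨colimit.desc ((OpenNhds.inclusion x).op ⋙ F)
    ⟨Z, ⟨fun V => θ V.unop.1 V.unop.2, fun V W i => ?_⟩⟩, fun V hV => ?_⟩
  · exact (hθ V.unop.1 W.unop.1 (leOfHom ((OpenNhds.inclusion x).map i.unop)) W.unop.2).trans
      (Category.comp_id _).symm
  · exact colimit.ι_desc (F := (OpenNhds.inclusion x).op ⋙ F) _ (op (⟨V, hV⟩ : OpenNhds x))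

variable {y : Point L 𝔹} {Z : ℬ}

/-- A compatible family of morphisms from the basic objects at the point `y`. -/
structure BasicCocone (y : Point L 𝔹) (Z : ℬ) where
  /-- the morphisms -/
  app : ∀ p : BasicPair U 𝔹, y ∈ basicSet L p → (p.cod ⟶ Z)
  w : ∀ {p q : BasicPair U 𝔹} (f : p ⟶ q) (hq : y ∈ basicSet L q),
    BasicPair.Hom.map f ≫ app q hq = app p (basicOpen_anti L f hq)

namespace BasicCocone

variable (θ : BasicCocone y Z)

theorem exists_stalkDesc : ∃ η : 𝔹.presheaf.stalk y.1 ⟶ Z,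
    ∀ p (hp : y ∈ basicSet L p), 𝔹.presheaf.germ p.u y.1 hp.1 ≫ η = p.n ≫ θ.app p hp := by
  obtain ⟨η, hη⟩ := exists_stalk_desc 𝔹.presheaf y.1
    (fun V hV => θ.app (BasicPair.ofOpen U V) ((mem_basicSet_ofOpen L).2 hV))
    (fun V W h hW => θ.w (BasicPair.ofOpenMap h) ((mem_basicSet_ofOpen L).2 hW))
  exact ⟨η, fun p hp => (hη p.u hp.1).trans (θ.w p.fromOpen hp).symm⟩

/-- The morphism from the stalk. -/
def stalkDesc : 𝔹.presheaf.stalk y.1 ⟶ Z := θ.exists_stalkDesc.choose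

theorem germ_stalkDesc {p} (hp : y ∈ basicSet L p) (hx : y.1 ∈ p.u) :
    𝔹.presheaf.germ p.u y.1 hx ≫ θ.stalkDesc = p.n ≫ θ.app p hp :=
  θ.exists_stalkDesc.choose_spec p hp

/-- One pair `q` whose pushout to the stalk is `n` defines `ρ`. Any other pair `p` over `n` maps to
a restriction of `q`, so compatibility of `θ` forces the value on `p`. -/
theorem exists_desc_of_isBasic {C : ℬ} {n : 𝔹.presheaf.stalk y.1 ⟶ C} (hn : IsBasic U n)
    {g : C ⟶ U.obj (L.obj y.2)} (hg : n ≫ g = L.unit y.2) :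
    ∃ ρ : C ⟶ Z, n ≫ ρ = θ.stalkDesc ∧ ∀ (p : BasicPair U 𝔹) (hp : y ∈ basicSet L p)
      (t : p.cod ⟶ C), p.n ≫ t = 𝔹.presheaf.germ p.u y.1 hp.1 ≫ n → t ≫ ρ = θ.app p hp := by
  obtain ⟨q, hx, t, po⟩ := exists_basicPair_of_stalk hn
  have hq : y ∈ basicSet L q := ⟨hx, t ≫ g, by rw [← po.w_assoc, hg]⟩
  refine ⟨po.desc θ.stalkDesc (θ.app q hq) (θ.germ_stalkDesc hq hx), po.inl_desc _ _ _,
    fun p hp t' ht' => ?_⟩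
  obtain ⟨w, hw, h, r, hr⟩ := BasicPair.exists_hom_to_restrict po hp.1 t' ht'
  have hqw : y ∈ basicSet L (q.restrict h) := (mem_basicSet_restrict L h).2 ⟨hq, hw⟩
  rw [← hr, Category.assoc]
  refine Eq.trans (congrArg (_ ≫ ·) ?_) (θ.w r hqw)
  apply pushout.hom_ext
  · refine Eq.trans ?_ (θ.w (q.toRestrict h) hqw).symm
    exact (reassoc_of% (BasicPair.toRestrict_restrictDesc po h hw)) _ |>.trans (po.inr_desc _ _ _)
  · refine Eq.trans ?_ (θ.germ_stalkDesc hqw hw)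
    exact (reassoc_of% (BasicPair.n_restrictDesc po h hw)) _ |>.trans
      (congrArg (_ ≫ ·) (po.inl_desc _ _ _))

/-- The morphisms of `exists_desc_of_isBasic` form a cocone on `V_ξ`, whose colimit is `U (A_ξ)`.
This is the existence half of the colimit property of `U (A_ξ)` over the pairs `p` with `y ∈ D_p`.
-/
theorem exists_desc [IsLocallyFinitelyPresentable.{v} ℬ] (hL : DiersCondition L) : ∃ ρ : U.obj (L.obj y.2) ⟶ Z,
    ∀ (p : BasicPair U 𝔹) (hp : y ∈ basicSet L p) (g : p.cod ⟶ U.obj (L.obj y.2)),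
      p.n ≫ g = 𝔹.presheaf.germ p.u y.1 hp.1 ≫ L.unit y.2 → g ≫ ρ = θ.app p hp := by
  choose ρ hρ hρ' using fun n : (below L y.2).FullSubcategory =>
    θ.exists_desc_of_isBasic n.property.1 n.property.2.choose_spec
  have nat : ∀ (m n : (below L y.2).FullSubcategory) (f : m ⟶ n), f.hom.right ≫ ρ n = ρ m := by
    intro m n f
    obtain ⟨q, hx, t, po⟩ := exists_basicPair_of_stalk m.property.1
    obtain ⟨g, hg⟩ := m.property.2
    have hq : y ∈ basicSet L q := ⟨hx, t ≫ g, by rw [← po.w_assoc, hg]⟩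
    have hf : m.obj.hom ≫ f.hom.right = n.obj.hom := Under.w f.hom
    refine po.hom_ext ?_ ?_
    · rw [reassoc_of% hf, hρ, hρ]
    · rw [hρ' m q hq t po.w.symm, ← Category.assoc, hρ' n q hq]
      rw [← po.w_assoc, hf]
  refine ⟨(hL.isColimitForget y.2).desc ⟨Z, ⟨ρ, fun m n f =>
    (nat m n f).trans (Category.comp_id _).symm⟩⟩, fun p hp g hg => ?_⟩
  -- The given `g` factors through the pushout of `p.n` to the stalk, and by `eq_ι` the induced
  -- morphism must be the colimit leg.
  let m : Under (𝔹.presheaf.stalk y.1) := Under.mk (pushout.inl (𝔹.presheaf.germ p.u y.1 hp.1) p.n)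
  let g' : m.right ⟶ U.obj (L.obj y.2) := pushout.desc (L.unit y.2) g hg.symm
  have hg' : m.hom ≫ g' = L.unit y.2 := pushout.inl_desc _ _ _
  let n : (below L y.2).FullSubcategory :=
    ⟨m, p.isBasic.of_isPushout (IsPushout.of_hasPushout _ _), g', hg'⟩
  have e := (hL.isColimitForget y.2).fac ⟨Z, ⟨ρ, fun m n f =>
    (nat m n f).trans (Category.comp_id _).symm⟩⟩ n
  have e' : g' ≫ _ = ρ n := (congrArg (· ≫ _) (hL.eq_ι y.2 n g' hg')).trans e
  have hgg : pushout.inr (𝔹.presheaf.germ p.u y.1 hp.1) p.n ≫ g' = g := pushout.inr_desc _ _ _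
  refine Eq.trans ?_ (hρ' n p hp (pushout.inr _ _) pushout.condition.symm)
  rw [← e']
  exact (congrArg (· ≫ _) hgg.symm).trans (Category.assoc _ _ _)

end BasicCocone

/-- Morphisms from a local object of the spectrum are determined on the basic objects. -/
theorem DiersCondition.localUnit_hom_ext (hL : DiersCondition L)
    {f f' : U.obj (L.obj y.2) ⟶ Z}
    (h : ∀ (p : BasicPair U 𝔹) (hp : y ∈ basicSet L p) (g : p.cod ⟶ U.obj (L.obj y.2)),
      p.n ≫ g = 𝔹.presheaf.germ p.u y.1 hp.1 ≫ L.unit y.2 → g ≫ f = g ≫ f') : f = f' := by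
  have hu : L.unit y.2 ≫ f = L.unit y.2 ≫ f' := by
    refine TopCat.Presheaf.stalk_hom_ext _ fun V hV => ?_
    have := h (BasicPair.ofOpen U V) ((mem_basicSet_ofOpen L).2 hV)
      (𝔹.presheaf.germ V y.1 hV ≫ L.unit y.2) (Category.id_comp _)
    exact (Category.assoc _ _ _).symm.trans (this.trans (Category.assoc _ _ _))
  refine (hL.isColimitForget y.2).hom_ext fun n => ?_
  obtain ⟨q, hx, t, po⟩ := exists_basicPair_of_stalk n.property.1
  have hn := hL.unit_ι y.2 n
  have hq : q.n ≫ t ≫ ((hL.ι y.2).app n).right = 𝔹.presheaf.germ q.u y.1 hx ≫ L.unit y.2 := by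
    rw [← po.w_assoc, hn]
  refine po.hom_ext ?_ ?_
  · exact ((Category.assoc _ _ _).symm.trans (congrArg (· ≫ f) hn)).trans
      (hu.trans ((Category.assoc _ _ _).symm.trans (congrArg (· ≫ f') hn)).symm)
  · exact (Category.assoc _ _ _).symm.trans ((h q ⟨hx, _, hq⟩ _ hq).trans (Category.assoc _ _ _))

end

section

variable {𝒜 : Type u'} [Category.{v'} 𝒜] {ℬ : Type u} [Category.{v} ℬ] {U : 𝒜 ⥤ ℬ}
  [HasColimits ℬ] {𝔹 : SheafedSpace.{u, v, v} ℬ} {L : LocalUnits U}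

/-! ### The universal property of the structural sheaf -/

/-- A compatible family of morphisms from the basic objects to the sections of a presheaf. -/
structure SectionFamily (G : TopCat.Presheaf ℬ (diersSpace L 𝔹)) where
  /-- the morphisms -/
  app : ∀ p : BasicPair U 𝔹, p.cod ⟶ G.obj (op (basicOpen L p))
  w : ∀ {p q : BasicPair U 𝔹} (f : p ⟶ q),
    BasicPair.Hom.map f ≫ app q = app p ≫ G.map (homOfLE (basicOpen_anti L f)).op

theorem SectionFamily.w_germ {F : TopCat.Presheaf ℬ (diersSpace L 𝔹)} (ε : SectionFamily F)
    {y : diersSpace L 𝔹} {p q : BasicPair U 𝔹} (f : p ⟶ q) (hq : y ∈ basicOpen L q) :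
    BasicPair.Hom.map f ≫ ε.app q ≫ F.germ (basicOpen L q) y hq =
      ε.app p ≫ F.germ (basicOpen L p) y (basicOpen_anti L f hq) := by
  rw [← Category.assoc, ε.w f, Category.assoc, TopCat.Presheaf.germ_res]

/-- The universal property of the structural sheaf with respect to sheaves on the Diers space. -/
def IsUniversalFamily {F : TopCat.Presheaf ℬ (diersSpace L 𝔹)} (ε : SectionFamily F) : Prop :=
  ∀ G : TopCat.Presheaf ℬ (diersSpace L 𝔹), G.IsSheaf → ∀ τ : SectionFamily G,
    ∃! β : F ⟶ G, ∀ p, ε.app p ≫ β.app (op (basicOpen L p)) = τ.app p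

/-- The family of sections given by an extension of the codomain functor. -/
def sectionFamily {P F : TopCat.Presheaf ℬ (diersSpace L 𝔹)}
    (ζ : codFunctor U 𝔹 ⟶ basicOpenFunctor L 𝔹 ⋙ P) (γ : P ⟶ F) : SectionFamily F where
  app p := ζ.app p ≫ γ.app (op (basicOpen L p))
  w {p q} f := by
    have h : BasicPair.Hom.map f ≫ ζ.app q =
      ζ.app p ≫ P.map (homOfLE (basicOpen_anti L f)).op := ζ.naturality f
    have h' := γ.naturality (homOfLE (basicOpen_anti L f)).op
    exact ((Category.assoc _ _ _).symm.trans (congrArg (· ≫ _) h)).trans ((Category.assoc _ _ _).trans ((congrArg (_ ≫ ·) h').trans (Category.assoc _ _ _).symm))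

theorem isUniversalFamily_of_isPointwiseLeftKanExtension
    {P F : TopCat.Presheaf ℬ (diersSpace L 𝔹)}
    (ζ : codFunctor U 𝔹 ⟶ basicOpenFunctor L 𝔹 ⋙ P)
    (hP : (Functor.LeftExtension.mk P ζ).IsPointwiseLeftKanExtension)
    (γ : P ⟶ F)
    (hγ : ∀ G : TopCat.Presheaf ℬ (diersSpace L 𝔹), G.IsSheaf →
      ∀ α : P ⟶ G, ∃! β : F ⟶ G, γ ≫ β = α) :
    IsUniversalFamily (sectionFamily ζ γ) := by
  intro G hG τ
  have : P.IsLeftKanExtension ζ := hP.isLeftKanExtension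
  let τ' : codFunctor U 𝔹 ⟶ basicOpenFunctor L 𝔹 ⋙ G := ⟨τ.app, fun _ _ f => τ.w f⟩
  obtain ⟨β, hβ, hβ'⟩ := hγ G hG (P.descOfIsLeftKanExtension ζ G τ')
  have key (δ : F ⟶ G) (p : BasicPair U 𝔹) :
      (sectionFamily ζ γ).app p ≫ δ.app (op (basicOpen L p)) =
        ζ.app p ≫ (γ ≫ δ).app (op (basicOpen L p)) := Category.assoc _ _ _
  refine ⟨β, fun p => ?_, fun δ hδ => hβ' δ ?_⟩
  · refine (key β p).trans (Eq.trans ?_ (P.descOfIsLeftKanExtension_fac_app ζ G τ' p))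
    rw [hβ]
    rfl
  · refine P.hom_ext_of_isLeftKanExtension ζ _ _ ?_
    ext p
    refine ((key δ p).symm.trans (hδ p)).trans ?_
    exact (P.descOfIsLeftKanExtension_fac_app ζ G τ' p).symm

/-- Morphisms from the stalk at `y` to `Z` are morphisms to the skyscraper sheaf at `y` with value
`Z`. A family with values in it is a family `θ` on the pairs with `y ∈ D_p`, completed by the only
morphism to a terminal object at the other pairs. -/
theorem IsUniversalFamily.existsUnique_stalk_desc [HasTerminal ℬ]
    {F : TopCat.Presheaf ℬ (diersSpace L 𝔹)} {ε : SectionFamily F} (hε : IsUniversalFamily ε)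
    {y : diersSpace L 𝔹} {Z : ℬ} (θ : ∀ p : BasicPair U 𝔹, y ∈ basicOpen L p → (p.cod ⟶ Z))
    (hθ : ∀ {p q : BasicPair U 𝔹} (f : p ⟶ q) (hq : y ∈ basicOpen L q),
      BasicPair.Hom.map f ≫ θ q hq = θ p (basicOpen_anti L f hq)) :
    ∃! σ : F.stalk y ⟶ Z, ∀ p (hp : y ∈ basicOpen L p),
      ε.app p ≫ F.germ (basicOpen L p) y hp ≫ σ = θ p hp := by
  classical
  let ht (V : Opens (diersSpace L 𝔹)) (h : y ∉ V) :
      IsTerminal ((skyscraperPresheaf y Z).obj (op V)) :=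
    (if_neg h).symm.ndrec terminalIsTerminal
  have hs (V : Opens (diersSpace L 𝔹)) (h : y ∈ V) :
      Z = (skyscraperPresheaf y Z).obj (op V) := (if_pos h).symm
  let τ : SectionFamily (skyscraperPresheaf y Z) :=
    { app := fun p => if h : y ∈ basicOpen L p then θ p h ≫ eqToHom (hs _ h)
        else (ht _ h).from _
      w := fun {p q} f => by
        by_cases hq : y ∈ basicOpen L q
        · have hp := basicOpen_anti L f hq
          have e : (skyscraperPresheaf y Z).map (homOfLE (basicOpen_anti L f)).op =
              eqToHom ((hs _ hp).symm.trans (hs _ hq)) := dif_pos hq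
          rw [e, dif_pos hp, dif_pos hq, Category.assoc, ← hθ f hq, Category.assoc,
            eqToHom_trans]
        · exact (ht _ hq).hom_ext _ _ }
  obtain ⟨β, hβ, hβ'⟩ := hε _ (skyscraperPresheaf_isSheaf y Z) τ
  have hτ (p) (hp : y ∈ basicOpen L p) : τ.app p ≫ eqToHom (hs _ hp).symm = θ p hp := by
    refine (congrArg (· ≫ _) (dif_pos hp)).trans ?_
    rw [Category.assoc, eqToHom_trans, eqToHom_refl, Category.comp_id]
  refine ⟨StalkSkyscraperPresheafAdjunctionAuxs.fromStalk y β, fun p hp => ?_, fun σ hσ => ?_⟩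
  · rw [StalkSkyscraperPresheafAdjunctionAuxs.germ_fromStalk, ← hτ p hp, ← hβ p]
    exact (Category.assoc _ _ _).symm
  · have e : StalkSkyscraperPresheafAdjunctionAuxs.toSkyscraperPresheaf y σ = β := by
      refine hβ' _ fun p => ?_
      by_cases hp : y ∈ basicOpen L p
      · refine (congrArg (_ ≫ ·) (dif_pos hp)).trans (Eq.trans ?_ (dif_pos hp).symm)
        rw [← hσ p hp, Category.assoc, Category.assoc]
      · exact (ht _ hp).hom_ext _ _
    rw [← e, StalkSkyscraperPresheafAdjunctionAuxs.fromStalk_to_skyscraper]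

/-- The stalk and `U (A_ξ)` both corepresent compatible families on the pairs `p` with `y ∈ D_p`, so
the comparison morphisms `σ` and `ρ` are mutually inverse. -/
theorem IsUniversalFamily.exists_stalkIso [IsLocallyFinitelyPresentable.{v} ℬ]
    (hL : DiersCondition L) {F : TopCat.Presheaf ℬ (diersSpace L 𝔹)} {ε : SectionFamily F}
    (hε : IsUniversalFamily ε) (y : diersSpace L 𝔹) :
    ∃ e : F.stalk y ≅ U.obj (L.obj (Sigma.snd y)), ∀ (p : BasicPair U 𝔹)
      (hy : y ∈ basicOpen L p) (hx : Sigma.fst y ∈ p.u)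
      (g : p.cod ⟶ U.obj (L.obj (Sigma.snd y))),
      p.n ≫ g = 𝔹.presheaf.germ p.u (Sigma.fst y) hx ≫ L.unit (Sigma.snd y) →
      ε.app p ≫ F.germ (basicOpen L p) y hy ≫ e.hom = g := by
  have := hasLimits_of_isLocallyFinitelyPresentable (ℬ := ℬ)
  have : HasTerminal ℬ := inferInstance
  have hθ (p : BasicPair U 𝔹) (hp : y ∈ basicOpen L p) : ∃ g : p.cod ⟶ U.obj (L.obj (Sigma.snd y)),
      p.n ≫ g = 𝔹.presheaf.germ p.u (Sigma.fst y) hp.1 ≫ L.unit (Sigma.snd y) := hp.2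
  choose θ hθ using hθ
  obtain ⟨σ, hσ, _⟩ := hε.existsUnique_stalk_desc (y := y) θ fun {p q} f hq => by
    refine p.isBasic.hom_ext hL ?_
    rw [hθ, reassoc_of% BasicPair.Hom.w f, hθ, TopCat.Presheaf.germ_res_assoc]
  obtain ⟨ρ, hρ⟩ := BasicCocone.exists_desc (L := L) (y := y) (Z := F.stalk y)
    ⟨fun p hp => ε.app p ≫ F.germ (basicOpen L p) y hp, ε.w_germ⟩ hL
  refine ⟨⟨σ, ρ, ?_, ?_⟩, fun p hy hx g hg => ?_⟩
  · obtain ⟨_, _, h⟩ := hε.existsUnique_stalk_desc (y := y) (Z := F.stalk y)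
      (fun p hp => ε.app p ≫ F.germ (basicOpen L p) y hp) ε.w_germ
    refine (h _ fun p hp => ?_).trans (h (𝟙 _) fun p hp => ?_).symm
    · exact (reassoc_of% (hσ p hp)) ρ |>.trans (hρ p hp (θ p hp) (hθ p hp))
    · rw [Category.comp_id]
  · refine hL.localUnit_hom_ext (𝔹 := 𝔹) fun p hp g hg => ?_
    have hg' : g = θ p hp := p.isBasic.hom_ext hL (hg.trans (hθ p hp).symm)
    rw [← Category.assoc, hρ p hp g hg, Category.assoc, Category.comp_id, hg']
    exact hσ p hp
  · exact (hσ p hy).trans (p.isBasic.hom_ext hL ((hθ p hy).trans hg.symm))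

/-- Makes the colimits of the pointwise left Kan extension essentially small, hence existent. -/
instance essentiallySmall_basicPair [IsLocallyFinitelyPresentable.{v} ℬ] (𝔹 : SheafedSpace.{u, v, v} ℬ) :
    EssentiallySmall.{v} (BasicPair U 𝔹) := by
  refine essentiallySmall_of_relation
    (T := Σ u : Opens 𝔹, BasicPresentation (𝔹.presheaf.obj (op u)))
    (fun t p => ∃ (C : ℬ) (n : _ ⟶ C) (hn : IsBasic U n), t.2.Presents n ∧ p = ⟨t.1, C, n, hn⟩)
    (fun p => ?_) ?_
  · obtain ⟨t, ht⟩ := p.isBasic.exists_presents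
    exact ⟨⟨p.u, t⟩, p.cod, p.n, p.isBasic, ht, rfl⟩
  · rintro ⟨u, t⟩ _ _ ⟨C, n, hn, ht, rfl⟩ ⟨C', n', hn', ht', rfl⟩
    obtain ⟨e, he⟩ := ht.exists_iso ht'
    have h : 𝔹.presheaf.map (homOfLE (le_refl u)).op = 𝟙 _ := 𝔹.presheaf.map_id _
    refine ⟨⟨BasicPair.Hom.mk le_rfl e.hom ?_, BasicPair.Hom.mk le_rfl e.inv ?_,
      BasicPair.Hom.ext e.hom_inv_id, BasicPair.Hom.ext e.inv_hom_id⟩⟩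
    · rw [h, Category.id_comp, he]
    · rw [h, Category.id_comp]
      exact e.comp_inv_eq.2 he.symm

theorem nonempty_structuralSheaf [IsLocallyFinitelyPresentable.{v} ℬ] (hL : DiersCondition L)
    (𝔹 : SheafedSpace.{u, v, v} ℬ) : Nonempty (StructuralSheaf L 𝔹) := by
  have := hasLimits_of_isLocallyFinitelyPresentable (ℬ := ℬ)
  have : (basicOpenFunctor L 𝔹).HasPointwiseLeftKanExtension (codFunctor U 𝔹) := fun V =>
    hasColimitsOfShape_of_essentiallySmall.{v} _ _ |>.has_colimit _
  let P := (basicOpenFunctor L 𝔹).pointwiseLeftKanExtension (codFunctor U 𝔹)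
  let ζ := (basicOpenFunctor L 𝔹).pointwiseLeftKanExtensionUnit (codFunctor U 𝔹)
  let hP : (Functor.LeftExtension.mk P ζ).IsPointwiseLeftKanExtension :=
    (basicOpenFunctor L 𝔹).pointwiseLeftKanExtensionIsPointwiseLeftKanExtension (codFunctor U 𝔹)
  let J := Opens.grothendieckTopology (diersSpace L 𝔹)
  have hγ : ∀ G : TopCat.Presheaf ℬ (diersSpace L 𝔹), G.IsSheaf →
      ∀ α : P ⟶ G, ∃! β : J.sheafify P ⟶ G, J.toSheafify P ≫ β = α := fun G hG α =>
    ⟨J.sheafifyLift α hG, J.toSheafify_sheafifyLift α hG, J.sheafifyLift_unique α hG⟩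
  choose e he using
    (isUniversalFamily_of_isPointwiseLeftKanExtension ζ hP (J.toSheafify P) hγ).exists_stalkIso hL
  exact ⟨⟨P, ζ, hP, J.sheafify P, sheafify_isSheaf_of_isLocallyFinitelyPresentable J P,
    J.toSheafify P, hγ, e, fun p y => he y p⟩⟩

end

section

variable {𝒜 : Type u'} [Category.{v'} 𝒜] {ℬ : Type u} [Category.{v} ℬ] {U : 𝒜 ⥤ ℬ}

/-! ### The maps on sections induced by a morphism of sheafed spaces -/

section sectionMap

variable {X Y Z : SheafedSpace.{u, v, v} ℬ}

/-- The map induced on the sections over opens `V`, `W` with `W ⊆ a⁻¹ V`. -/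
def sectionMap (a : X ⟶ Y) (V : Opens Y) (W : Opens X) (h : W ≤ (Opens.map a.hom.base).obj V) :
    Y.presheaf.obj (op V) ⟶ X.presheaf.obj (op W) :=
  a.hom.c.app (op V) ≫ X.presheaf.map (homOfLE h).op

theorem sectionMap_preimage (a : X ⟶ Y) (V : Opens Y) :
    sectionMap a V _ le_rfl = a.hom.c.app (op V) :=
  (congrArg (_ ≫ ·) (X.presheaf.map_id _)).trans (Category.comp_id _)

theorem sectionMap_congr {a b : X ⟶ Y} (h : a = b) {V : Opens Y} {W : Opens X}
    (ha : W ≤ (Opens.map a.hom.base).obj V) :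
    sectionMap a V W ha = sectionMap b V W (h ▸ ha) := by
  subst h
  rfl

theorem sectionMap_res (a : X ⟶ Y) {V : Opens Y} {W W' : Opens X}
    (h : W ≤ (Opens.map a.hom.base).obj V) (h' : W' ≤ W) :
    sectionMap a V W h ≫ X.presheaf.map (homOfLE h').op = sectionMap a V W' (h'.trans h) :=
  (Category.assoc _ _ _).trans (congrArg (_ ≫ ·) (res_res X.presheaf h' h))

theorem res_sectionMap (a : X ⟶ Y) {V V' : Opens Y} {W : Opens X} (h : V' ≤ V)
    (h' : W ≤ (Opens.map a.hom.base).obj V') :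
    Y.presheaf.map (homOfLE h).op ≫ sectionMap a V' W h' =
      sectionMap a V W (h'.trans fun _ hx => h hx) := by
  have e := a.hom.c.naturality (homOfLE h).op
  refine (Category.assoc _ _ _).symm.trans ((congrArg (· ≫ _) e).trans ?_)
  exact (Category.assoc _ _ _).trans (congrArg (_ ≫ ·)
    (res_res X.presheaf h' fun _ hx => h hx))

theorem sectionMap_comp (a : X ⟶ Y) (b : Y ⟶ Z) {V : Opens Z} {W : Opens Y} {N : Opens X}
    (h : W ≤ (Opens.map b.hom.base).obj V) (h' : N ≤ (Opens.map a.hom.base).obj W) :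
    sectionMap b V W h ≫ sectionMap a W N h' =
      sectionMap (a ≫ b) V N (h'.trans fun _ hx => h hx) :=
  (Category.assoc _ _ _).trans ((congrArg (_ ≫ ·) (res_sectionMap a h h')).trans
    (Category.assoc _ _ _).symm)

/-- Comparing on all `W` inside both preimages avoids transport along the equality of the base maps.
-/
theorem hom_ext_sectionMap {a b : X ⟶ Y} (h : ∀ x : X, a.hom.base x = b.hom.base x)
    (h' : ∀ (V : Opens Y) (W : Opens X) (ha : W ≤ (Opens.map a.hom.base).obj V)
      (hb : W ≤ (Opens.map b.hom.base).obj V), sectionMap a V W ha = sectionMap b V W hb) :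
    a = b := by
  obtain ⟨⟨f, c⟩⟩ := a
  obtain ⟨⟨g, d⟩⟩ := b
  obtain rfl : f = g := TopCat.hom_ext (ContinuousMap.ext h)
  congr 2
  apply NatTrans.ext
  funext V
  have e := h' V.unop _ le_rfl le_rfl
  rwa [sectionMap_preimage, sectionMap_preimage] at e

variable [HasColimits ℬ]

theorem germ_stalkMap (a : X ⟶ Y) {V : Opens Y} {W : Opens X}
    (h : W ≤ (Opens.map a.hom.base).obj V) {x : X} (hx : x ∈ W) :
    Y.presheaf.germ V (a.hom.base x) (h hx) ≫ a.hom.stalkMap x =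
      sectionMap a V W h ≫ X.presheaf.germ W x hx := by
  refine (PresheafedSpace.stalkMap_germ a.hom V x (h hx)).trans ?_
  exact (congrArg (fun t => a.hom.c.app (op V) ≫ t)
    (X.presheaf.germ_res (homOfLE h) x hx).symm).trans (Category.assoc _ _ _).symm

end sectionMap

variable [HasColimits ℬ] {𝔹 : SheafedSpace.{u, v, v} ℬ} {L : LocalUnits U}

/-! ### The canonical morphism from the spectrum -/

/-- The pushout of `n` to the stalk is diagonally universal, so it factors `f` exactly when it
factors the local unit of `f`. Membership can thus be tested on `f` itself. -/
theorem mem_basicSet_idx [IsLocallyFinitelyPresentable.{v} ℬ] {x : 𝔹} {A : 𝒜}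
    (f : 𝔹.presheaf.stalk x ⟶ U.obj A) (p : BasicPair U 𝔹) :
    (⟨x, L.idx f⟩ : Point L 𝔹) ∈ basicSet L p ↔
      ∃ (hx : x ∈ p.u) (g : p.cod ⟶ U.obj A), p.n ≫ g = 𝔹.presheaf.germ p.u x hx ≫ f := by
  constructor
  · rintro ⟨hx, g, hg⟩
    refine ⟨hx, g ≫ U.map (L.lift f), ?_⟩
    rw [reassoc_of% hg, L.fac f]
  · rintro ⟨hx, g, hg⟩
    have hm := p.isBasic.of_isPushout (IsPushout.of_hasPushout (𝔹.presheaf.germ p.u x hx) p.n)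
    obtain ⟨g', hg'⟩ := (L.exists_fac_iff hm.isDiagUniversal f).2
      ⟨pushout.desc f g hg.symm, pushout.inl_desc _ _ _⟩
    refine ⟨hx, pushout.inr _ _ ≫ g', ?_⟩
    rw [← pushout.condition_assoc, hg']

namespace StructuralSheaf

variable (S : StructuralSheaf L 𝔹)

/-- The canonical maps to the sections, as a compatible family. -/
abbrev family : SectionFamily S.sheaf := sectionFamily S.ζ S.γ

theorem isUniversalFamily : IsUniversalFamily S.family :=
  isUniversalFamily_of_isPointwiseLeftKanExtension S.ζ S.isKan S.γ S.isSheafification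

theorem toSections_w {p q : BasicPair U 𝔹} (f : p ⟶ q) :
    BasicPair.Hom.map f ≫ S.toSections q =
      S.toSections p ≫ S.sheaf.map (homOfLE (basicOpen_anti L f)).op :=
  S.family.w f

/-- The canonical morphism from the spectrum of `𝔹` to `𝔹`. -/
def toSpace : S.spectrum.space ⟶ 𝔹 :=
  InducedCategory.homMk
    { base := TopCat.ofHom (Y := 𝔹.carrier) ⟨fun y : Point L 𝔹 => y.1, by
        refine continuous_def.2 fun V hV => ?_
        have e : (fun y : Point L 𝔹 => y.1) ⁻¹' V =
            basicSet L (BasicPair.ofOpen U (⟨V, hV⟩ : Opens 𝔹)) :=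
          Set.ext fun y => (mem_basicSet_ofOpen L (w := ⟨V, hV⟩)).symm
        rw [e]
        exact (basicOpen L _).2⟩
      c :=
        -- The preimage of `V` is `D_(V, id)`; the restriction only passes between these two
        -- descriptions of one open.
        { app := fun V => S.toSections (BasicPair.ofOpen U V.unop) ≫
            S.sheaf.map (homOfLE fun _ hy => (mem_basicSet_ofOpen L).2 hy).op
          naturality := fun V W i => by
            have e := S.toSections_w (BasicPair.ofOpenMap (U := U) (leOfHom i.unop))
            refine (Category.assoc _ _ _).symm.trans ((congrArg (· ≫ _) e).trans ?_)
            refine (Category.assoc _ _ _).trans (Eq.trans ?_ (Category.assoc _ _ _).symm)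
            exact congrArg (_ ≫ ·) ((res_res S.sheaf _ _).trans (res_res S.sheaf _ _).symm) } }

theorem sectionMap_toSpace (p : BasicPair U 𝔹)
    (h : basicOpen L p ≤ (Opens.map S.toSpace.hom.base).obj p.u) :
    sectionMap S.toSpace p.u (basicOpen L p) h = p.n ≫ S.toSections p := by
  refine (Category.assoc _ _ _).trans ((congrArg (_ ≫ ·) (res_res S.sheaf _ _)).trans ?_)
  exact (S.toSections_w p.fromOpen).symm

theorem basicOpen_le (p : BasicPair U 𝔹) :
    basicOpen L p ≤ (Opens.map S.toSpace.hom.base).obj p.u := fun _ hy => hy.1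

theorem stalkMap_toSpace (y : diersSpace L 𝔹) :
    S.toSpace.hom.stalkMap y ≫ (S.stalkIso y).hom = L.unit (Sigma.snd y) := by
  refine TopCat.Presheaf.stalk_hom_ext _ fun V hV => ?_
  have hy : y ∈ basicOpen L (BasicPair.ofOpen U V) := (mem_basicSet_ofOpen L).2 hV
  have e := germ_stalkMap S.toSpace (S.basicOpen_le (BasicPair.ofOpen U V)) hy
  refine (Category.assoc _ _ _).symm.trans ((congrArg (· ≫ _) e).trans ?_)
  refine (Category.assoc _ _ _).trans ((congrArg (· ≫ _)
    (S.sectionMap_toSpace (BasicPair.ofOpen U V) _)).trans ?_)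
  refine (congrArg (· ≫ _) (Category.id_comp _)).trans ?_
  exact S.germ_stalkIso (BasicPair.ofOpen U V) y hy hV _ (Category.id_comp _)

theorem isCanonicalUnit_toSpace {𝔹 : BSpace ℬ} (S : StructuralSheaf L 𝔹.unop) :
    IsCanonicalUnit S (Quiver.Hom.op S.toSpace) :=
  ⟨fun _ => rfl, fun p => ⟨S.basicOpen_le p, S.sectionMap_toSpace p _⟩⟩

end StructuralSheaf

end

section

variable {𝒜 : Type u'} [Category.{v'} 𝒜] {ℬ : Type u} [Category.{v} ℬ] {U : 𝒜 ⥤ ℬ}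

/-! ### The universal property of the spectrum -/

theorem comp_eq_comp_of_facs {P C F G Q A E R : ℬ} {n : P ⟶ C} {ε : C ⟶ F} {γ : F ⟶ G}
    {σ : G ⟶ Q} {i : Q ⟶ E} {s : F ⟶ R} {γ' : R ⟶ Q} {j : G ⟶ A} {l : A ⟶ E} {t : C ⟶ R}
    {g : C ⟶ A} {r : P ⟶ R} {m : P ⟶ E} (h₁ : γ ≫ σ = s ≫ γ') (h₂ : ε ≫ s = t)
    (h₃ : n ≫ t = r) (h₄ : r ≫ γ' ≫ i = m) (h₅ : ε ≫ γ ≫ j = g) (h₆ : n ≫ g ≫ l = m) :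
    n ≫ ε ≫ γ ≫ σ ≫ i = n ≫ ε ≫ γ ≫ j ≫ l := by
  rw [reassoc_of% h₁, reassoc_of% h₂, reassoc_of% h₃, h₄, reassoc_of% h₅, h₆]

variable [HasColimits ℬ] {𝔹 : SheafedSpace.{u, v, v} ℬ} {L : LocalUnits U}

theorem IsUniversalFamily.stalk_hom_ext [HasTerminal ℬ]
    {F : TopCat.Presheaf ℬ (diersSpace L 𝔹)} {ε : SectionFamily F} (hε : IsUniversalFamily ε)
    {y : diersSpace L 𝔹} {Z : ℬ} {f g : F.stalk y ⟶ Z}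
    (h : ∀ p (hp : y ∈ basicOpen L p), ε.app p ≫ F.germ (basicOpen L p) y hp ≫ f =
      ε.app p ≫ F.germ (basicOpen L p) y hp ≫ g) : f = g := by
  obtain ⟨_, _, e⟩ := hε.existsUnique_stalk_desc (y := y) (Z := Z)
    (fun p hp => ε.app p ≫ F.germ (basicOpen L p) y hp ≫ g) fun f hq => by
      rw [reassoc_of% (ε.w_germ f hq)]
  exact (e f h).trans (e g fun _ _ => rfl).symm

namespace StructuralSheaf

variable (S : StructuralSheaf L 𝔹) {Y : USpace U}

/-- The map on the stalk at the image of `y` to the local object at `y`. -/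
def localMap (φ : Y.space ⟶ 𝔹) (y : Y.space) :
    𝔹.presheaf.stalk (φ.hom.base y) ⟶ U.obj (Y.loc y) :=
  φ.hom.stalkMap y ≫ (Y.stalkIso y).hom

theorem germ_localMap (φ : Y.space ⟶ 𝔹) {y : Y.space} {V : Opens 𝔹} {W : Opens Y.space}
    (h : W ≤ (Opens.map φ.hom.base).obj V) (hy : y ∈ W) :
    𝔹.presheaf.germ V (φ.hom.base y) (h hy) ≫ localMap φ y =
      sectionMap φ V W h ≫ Y.space.presheaf.germ W y hy ≫ (Y.stalkIso y).hom :=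
  (Category.assoc _ _ _).symm.trans ((congrArg (· ≫ _) (germ_stalkMap φ h hy)).trans
    (Category.assoc _ _ _))

variable (L) in
/-- The local unit at `y`, together with the local map, induced by a morphism to `𝔹`. -/
def liftPoint (φ : Y.space ⟶ 𝔹) (y : Y.space) : Σ z : Point L 𝔹, (L.obj z.2 ⟶ Y.loc y) :=
  ⟨⟨φ.hom.base y, L.idx (localMap φ y)⟩, L.lift (localMap φ y)⟩

theorem isOpen_preimage_liftPoint [IsLocallyFinitelyPresentable.{v} ℬ] (φ : Y.space ⟶ 𝔹)
    (p : BasicPair U 𝔹) : IsOpen {y : Y.space | (liftPoint L φ y).1 ∈ basicSet L p} := by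
  refine Eq.mpr (congrArg IsOpen (Set.ext fun y => ?_)) (p.isBasic.isOpen_setOf_factorization
    Y.stalkIso (sectionMap φ p.u _ le_rfl))
  refine (mem_basicSet_idx (localMap φ y) p).trans ?_
  refine exists_congr fun hx => exists_congr fun g => ?_
  rw [germ_localMap φ le_rfl hx]

/-- The stalk map of `S.toSpace` is the local unit, so `USpace.Hom.comm` exhibits the local map of
the composite as a local unit followed by `U (loc y)`. Uniqueness of that factorization recovers
both the point and the local map. -/
theorem liftPoint_comp (a : S.spectrum ⟶ Y) (y : Y.space) :
    liftPoint L (USpace.Hom.hom a ≫ S.toSpace) y =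
      ⟨(USpace.Hom.hom a).hom.base y, USpace.Hom.loc a y⟩ := by
  let z : diersSpace L 𝔹 := (USpace.Hom.hom a).hom.base y
  have h : (USpace.Hom.hom a ≫ S.toSpace).hom.stalkMap y =
      S.toSpace.hom.stalkMap z ≫ (USpace.Hom.hom a).hom.stalkMap y :=
    PresheafedSpace.stalkMap.comp (USpace.Hom.hom a).hom S.toSpace.hom y
  have e : localMap (USpace.Hom.hom a ≫ S.toSpace) y =
      L.unit (Sigma.snd z) ≫ U.map (USpace.Hom.loc a y) := by
    refine (congrArg (· ≫ _) h).trans ((Category.assoc _ _ _).trans ?_)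
    refine (congrArg (_ ≫ ·) (USpace.Hom.comm a y)).trans ((Category.assoc _ _ _).symm.trans ?_)
    exact congrArg (· ≫ _) (S.stalkMap_toSpace z)
  exact congrArg (fun w : Σ ξ : L.Idx (𝔹.presheaf.stalk (Sigma.fst z)), (L.obj ξ ⟶ Y.loc y) =>
    (⟨⟨Sigma.fst z, w.1⟩, w.2⟩ : Σ z : Point L 𝔹, (L.obj z.2 ⟶ Y.loc y)))
    (L.eq_of_fac _ _ e.symm).symm

variable (L) in
/-- The continuous map to the spectrum induced by a morphism to `𝔹`. -/
def liftBase [IsLocallyFinitelyPresentable.{v} ℬ] (φ : Y.space ⟶ 𝔹) :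
    Y.space.carrier ⟶ diersSpace L 𝔹 :=
  TopCat.ofHom (Y := Point L 𝔹) ⟨fun y => (liftPoint L φ y).1, continuous_generateFrom_iff.2 (by
    rintro _ ⟨p, rfl⟩
    exact isOpen_preimage_liftPoint φ p)⟩

variable [IsLocallyFinitelyPresentable.{v} ℬ]

theorem liftBase_le (φ : Y.space ⟶ 𝔹) (p : BasicPair U 𝔹) :
    (Opens.map (liftBase L φ)).obj (basicOpen L p) ≤ (Opens.map φ.hom.base).obj p.u := by
  rintro y ⟨hx, _⟩
  exact hx

theorem exists_factorization (hL : DiersCondition L) (φ : Y.space ⟶ 𝔹) (p : BasicPair U 𝔹) :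
    ∃ t : p.cod ⟶ Y.space.presheaf.obj (op ((Opens.map (liftBase L φ)).obj (basicOpen L p))),
      p.n ≫ t = sectionMap φ p.u _ (liftBase_le φ p) := by
  obtain ⟨t, ht⟩ := p.isBasic.exists_factorization hL Y.stalkIso Y.space.IsSheaf
    (V := (Opens.map φ.hom.base).obj p.u)
    (W := (Opens.map (liftBase L φ)).obj (basicOpen L p)) (liftBase_le φ p)
    (sectionMap φ p.u _ le_rfl) fun y hy => by
      obtain ⟨hx, g, hg⟩ := (mem_basicSet_idx (localMap φ y) p).1 hy
      exact ⟨g, hg.trans (germ_localMap φ le_rfl hx)⟩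
  exact ⟨t, ht.trans (sectionMap_res φ _ _)⟩

/-- The factorizations `t p` are a compatible family, by their uniqueness, in the pushforward of the
sheaf of `Y` along `liftBase`; the universal property turns them into the comorphism. -/
theorem exists_lift (hL : DiersCondition L) (φ : Y.space ⟶ 𝔹) :
    ∃ h : S.spectrum ⟶ Y, USpace.Hom.hom h ≫ S.toSpace = φ := by
  have := hasLimits_of_isLocallyFinitelyPresentable (ℬ := ℬ)
  have : HasTerminal ℬ := inferInstance
  choose t ht using exists_factorization hL φ
  let G : TopCat.Presheaf ℬ (diersSpace L 𝔹) :=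
    (TopCat.Presheaf.pushforward ℬ (liftBase L φ)).obj Y.space.presheaf
  have hG : G.IsSheaf := TopCat.Sheaf.pushforward_sheaf_of_sheaf _ Y.space.IsSheaf
  obtain ⟨c, hc, _⟩ := S.isUniversalFamily G hG ⟨t, fun {p q} f =>
    p.isBasic.hom_ext_sections hL Y.stalkIso Y.space.IsSheaf (by
      have h₁ : (Opens.map (liftBase L φ)).obj (basicOpen L q) ≤
        (Opens.map (liftBase L φ)).obj (basicOpen L p) := fun _ hy => basicOpen_anti L f hy
      refine (reassoc_of% (BasicPair.Hom.w f)) (t q) |>.trans ?_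
      refine (congrArg (_ ≫ ·) (ht q)).trans ((res_sectionMap φ _ _).trans ?_)
      exact (sectionMap_res φ _ h₁).symm.trans
        ((congrArg (· ≫ Y.space.presheaf.map (homOfLE h₁).op) (ht p)).symm.trans
          (Category.assoc _ _ _)))⟩
  let a : Y.space ⟶ S.spectrum.space := InducedCategory.homMk ⟨liftBase L φ, c⟩
  have ha (p : BasicPair U 𝔹) : S.toSections p ≫ sectionMap a (basicOpen L p) _ le_rfl = t p :=
    (congrArg (_ ≫ ·) (sectionMap_preimage a _)).trans (hc p)
  refine ⟨USpace.Hom.mk a (fun y => (liftPoint L φ y).2) fun y => ?_, ?_⟩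
  -- Both sides end in an object `U A`, so it is enough to compare them on each `p.cod`, and there
  -- after composition with `p.n`, where each is induced by `φ`.
  · refine S.isUniversalFamily.stalk_hom_ext fun p hp => p.isBasic.hom_ext hL ?_
    obtain ⟨hx, g, hg⟩ := id hp
    refine comp_eq_comp_of_facs (germ_stalkMap a (le_refl _) hp) (ha p) (ht p)
      (germ_localMap φ (liftBase_le φ p) hp).symm
      (S.germ_stalkIso p (a.hom.base y) hp hx g hg) ?_
    exact (reassoc_of% hg) _ |>.trans (congrArg (_ ≫ ·) (L.fac (localMap φ y)))
  · refine hom_ext_sectionMap (fun y => rfl) fun V W h h' => ?_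
    have hW : W ≤ (Opens.map a.hom.base).obj (basicOpen L (BasicPair.ofOpen U V)) :=
      fun y hy => (mem_basicSet_ofOpen L).2 (h' hy)
    refine (sectionMap_comp a S.toSpace (S.basicOpen_le (BasicPair.ofOpen U V)) hW).symm.trans ?_
    refine (congrArg (· ≫ _) ((S.sectionMap_toSpace (BasicPair.ofOpen U V) _).trans
      (Category.id_comp _))).trans ?_
    refine (congrArg (_ ≫ ·) (sectionMap_res a le_rfl hW).symm).trans ?_
    refine (Category.assoc _ _ _).symm.trans ((congrArg (· ≫ _) (ha _)).trans ?_)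
    refine (congrArg (· ≫ _) ((Category.id_comp _).symm.trans (ht (BasicPair.ofOpen U V)))).trans ?_
    exact sectionMap_res φ _ _

theorem toSections_sectionMap_ext (hL : DiersCondition L) {a b : Y.space ⟶ S.spectrum.space}
    (h : a ≫ S.toSpace = b ≫ S.toSpace) (p : BasicPair U 𝔹) {W : Opens Y.space}
    (ha : W ≤ (Opens.map a.hom.base).obj (basicOpen L p))
    (hb : W ≤ (Opens.map b.hom.base).obj (basicOpen L p)) :
    S.toSections p ≫ sectionMap a (basicOpen L p) W ha =
      S.toSections p ≫ sectionMap b (basicOpen L p) W hb := by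
  refine p.isBasic.hom_ext_sections hL Y.stalkIso Y.space.IsSheaf ?_
  have key {a : Y.space ⟶ S.spectrum.space}
      (ha : W ≤ (Opens.map a.hom.base).obj (basicOpen L p)) :
      p.n ≫ S.toSections p ≫ sectionMap a (basicOpen L p) W ha =
        sectionMap (a ≫ S.toSpace) p.u W (ha.trans fun _ hx => S.basicOpen_le p hx) :=
    (Category.assoc _ _ _).symm.trans ((congrArg (· ≫ _)
      (S.sectionMap_toSpace p (S.basicOpen_le p)).symm).trans (sectionMap_comp _ _ _ _))
  exact (key ha).trans ((sectionMap_congr h _).trans (key hb).symm)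

/-- Points and local maps are recovered by `liftPoint_comp`. The comorphisms are determined on the
basic objects, where composing with `n` gives back the composite with `S.toSpace`. -/
theorem lift_unique (hL : DiersCondition L) {a b : S.spectrum ⟶ Y}
    (h : USpace.Hom.hom a ≫ S.toSpace = USpace.Hom.hom b ≫ S.toSpace) : a = b := by
  have hab (y : Y.space) : (⟨(USpace.Hom.hom a).hom.base y, USpace.Hom.loc a y⟩ :
      Σ z : Point L 𝔹, (L.obj z.2 ⟶ Y.loc y)) =
        ⟨(USpace.Hom.hom b).hom.base y, USpace.Hom.loc b y⟩ :=
    (S.liftPoint_comp a y).symm.trans ((congrArg (fun φ => liftPoint L φ y) h).trans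
      (S.liftPoint_comp b y))
  obtain ⟨⟨⟨f, c⟩⟩, l, hl⟩ := a
  obtain ⟨⟨⟨g, d⟩⟩, m, hm⟩ := b
  obtain rfl : f = g := TopCat.hom_ext (ContinuousMap.ext fun y => congrArg Sigma.fst (hab y))
  let G : TopCat.Presheaf ℬ (diersSpace L 𝔹) :=
    (TopCat.Presheaf.pushforward ℬ f).obj Y.space.presheaf
  have hG : G.IsSheaf := TopCat.Sheaf.pushforward_sheaf_of_sheaf _ Y.space.IsSheaf
  obtain ⟨_, _, e⟩ := S.isUniversalFamily G hG ⟨fun p => S.toSections p ≫ c.app _, fun {p q} i =>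
    ((Category.assoc _ _ _).symm.trans (congrArg (· ≫ _) (S.toSections_w i))).trans
      ((Category.assoc _ _ _).trans ((congrArg (_ ≫ ·) (c.naturality _)).trans
        (Category.assoc _ _ _).symm))⟩
  obtain rfl : d = c := by
    refine (e d fun p => ?_).trans (e c fun p => rfl).symm
    have key (c) := sectionMap_preimage (X := Y.space) (Y := S.spectrum.space) ⟨⟨f, c⟩⟩
      (basicOpen L p)
    exact (congrArg (_ ≫ ·) (key d).symm).trans
      ((S.toSections_sectionMap_ext hL h p le_rfl le_rfl).symm.trans (congrArg (_ ≫ ·) (key c)))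
  congr 1
  exact funext fun y => eq_of_heq (Sigma.mk.inj (hab y)).2

end StructuralSheaf

end

section

variable {𝒜 : Type u'} [Category.{v'} 𝒜] {ℬ : Type u} [Category.{v} ℬ] {U : 𝒜 ⥤ ℬ}

/-! ### The spectrum functor and its adjunction -/

theorem exists_eqToHom_of_sigma_eq {P : Type*} {f : P → 𝒜} {A : 𝒜} {a b : P}
    {l : f a ⟶ A} {m : f b ⟶ A} (h : (⟨a, l⟩ : Σ z : P, (f z ⟶ A)) = ⟨b, m⟩) :
    ∃ h : a = b, l = eqToHom (congrArg f h) ≫ m := by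
  cases h
  exact ⟨rfl, by simp⟩

variable [HasColimits ℬ] {L : LocalUnits U}

theorem liftPoint_toSpace_comp (S : ∀ 𝔹 : SheafedSpace.{u, v, v} ℬ, StructuralSheaf L 𝔹)
    {𝔹₁ 𝔹₂ : BSpace ℬ} (φ : 𝔹₁ ⟶ 𝔹₂) (y : diersSpace L 𝔹₂.unop) :
    StructuralSheaf.liftPoint L (Y := (S 𝔹₂.unop).spectrum) ((S 𝔹₂.unop).toSpace ≫ φ.unop) y =
      ⟨specPoint L φ y, specLoc L φ y⟩ := by
  have h : ((S 𝔹₂.unop).toSpace ≫ φ.unop).hom.stalkMap y =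
      φ.unop.hom.stalkMap (Sigma.fst y) ≫ (S 𝔹₂.unop).toSpace.hom.stalkMap y :=
    PresheafedSpace.stalkMap.comp (S 𝔹₂.unop).toSpace.hom φ.unop.hom y
  have e : StructuralSheaf.localMap (Y := (S 𝔹₂.unop).spectrum)
      ((S 𝔹₂.unop).toSpace ≫ φ.unop) y =
      φ.unop.hom.stalkMap (Sigma.fst y) ≫ L.unit (Sigma.snd y) := by
    refine (congrArg (· ≫ _) h).trans ((Category.assoc _ _ _).trans ?_)
    exact congrArg (_ ≫ ·) ((S 𝔹₂.unop).stalkMap_toSpace y)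
  exact congrArg (fun f : 𝔹₁.unop.presheaf.stalk (φ.unop.hom.base (Sigma.fst y)) ⟶
    U.obj (L.obj (Sigma.snd y)) => (⟨⟨φ.unop.hom.base (Sigma.fst y), L.idx f⟩, L.lift f⟩ :
      Σ z : Point L 𝔹₁.unop, (L.obj z.2 ⟶ L.obj (Sigma.snd y)))) e

variable [IsLocallyFinitelyPresentable.{v} ℬ]

namespace StructuralSheaf

variable {𝔹 : SheafedSpace.{u, v, v} ℬ} (S : StructuralSheaf L 𝔹) {Y : USpace U}
  (hL : DiersCondition L)

/-- The morphism from the spectrum induced by a morphism of `ℬ`-spaces. -/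
def lift (φ : Y.space ⟶ 𝔹) : S.spectrum ⟶ Y := (S.exists_lift hL φ).choose

theorem lift_toSpace (φ : Y.space ⟶ 𝔹) : (S.lift hL φ).hom ≫ S.toSpace = φ :=
  (S.exists_lift hL φ).choose_spec

end StructuralSheaf

variable (S : ∀ 𝔹 : SheafedSpace.{u, v, v} ℬ, StructuralSheaf L 𝔹) (hL : DiersCondition L)
  {𝔹₁ 𝔹₂ 𝔹₃ : BSpace ℬ}

/-- The morphism of spectra induced by a morphism of `ℬ`-spaces. -/
def specMap (φ : 𝔹₁ ⟶ 𝔹₂) : (S 𝔹₁.unop).spectrum ⟶ (S 𝔹₂.unop).spectrum :=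
  (S 𝔹₁.unop).lift hL ((S 𝔹₂.unop).toSpace ≫ φ.unop)

theorem specMap_toSpace (φ : 𝔹₁ ⟶ 𝔹₂) :
    (specMap S hL φ).hom ≫ (S 𝔹₁.unop).toSpace = (S 𝔹₂.unop).toSpace ≫ φ.unop :=
  (S 𝔹₁.unop).lift_toSpace hL _

theorem specMap_id (𝔹 : BSpace ℬ) : specMap S hL (𝟙 𝔹) = 𝟙 _ :=
  (S 𝔹.unop).lift_unique hL ((specMap_toSpace S hL (𝟙 𝔹)).trans
    ((Category.comp_id _).trans (Category.id_comp _).symm))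

theorem specMap_comp (φ : 𝔹₁ ⟶ 𝔹₂) (ψ : 𝔹₂ ⟶ 𝔹₃) :
    specMap S hL (φ ≫ ψ) = specMap S hL φ ≫ specMap S hL ψ := by
  refine (S 𝔹₁.unop).lift_unique hL ((specMap_toSpace S hL (φ ≫ ψ)).trans ?_)
  have e : (specMap S hL φ ≫ specMap S hL ψ).hom =
    (specMap S hL ψ).hom ≫ (specMap S hL φ).hom := rfl
  rw [e, Category.assoc, specMap_toSpace, reassoc_of% (specMap_toSpace S hL ψ)]
  rfl

theorem specMap_point (φ : 𝔹₁ ⟶ 𝔹₂) (y : diersSpace L 𝔹₂.unop) :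
    (⟨(specMap S hL φ).hom.hom.base y, (specMap S hL φ).loc y⟩ :
      Σ z : Point L 𝔹₁.unop, (L.obj z.2 ⟶ L.obj (Sigma.snd y))) =
      ⟨specPoint L φ y, specLoc L φ y⟩ :=
  ((S 𝔹₁.unop).liftPoint_comp (specMap S hL φ) y).symm.trans
    ((congrArg (fun φ => StructuralSheaf.liftPoint L (Y := (S 𝔹₂.unop).spectrum) φ y)
      (specMap_toSpace S hL φ)).trans (liftPoint_toSpace_comp S φ y))

theorem specPoint_mem_basicSet (φ : 𝔹₁ ⟶ 𝔹₂) {p : BasicPair U 𝔹₁.unop} {C : ℬ}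
    {m : 𝔹₂.unop.presheaf.obj (op ((Opens.map φ.unop.hom.base).obj p.u)) ⟶ C}
    (hm : IsBasic U m) {k : p.cod ⟶ C} (h : IsPushout (φ.unop.hom.c.app (op p.u)) p.n m k)
    (y : diersSpace L 𝔹₂.unop) : specPoint L φ y ∈ basicSet L p ↔
      y ∈ basicSet L (⟨(Opens.map φ.unop.hom.base).obj p.u, C, m, hm⟩ : BasicPair U 𝔹₂.unop) := by
  refine (mem_basicSet_idx _ p).trans (exists_congr fun hx => ?_)
  have e := germ_stalkMap φ.unop (le_refl ((Opens.map φ.unop.hom.base).obj p.u)) hx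
  rw [sectionMap_preimage] at e
  have e' := (congrArg (· ≫ L.unit (Sigma.snd y)) e).trans (Category.assoc _ _ _)
  have e'' := (Category.assoc _ _ _).symm.trans e'
  constructor
  · rintro ⟨g, hg⟩
    exact ⟨h.desc _ g (e''.symm.trans hg.symm), h.inl_desc _ _ _⟩
  · rintro ⟨g, hg⟩
    refine ⟨k ≫ g, (h.w_assoc g).symm.trans (Eq.trans ?_ e''.symm)⟩
    exact congrArg (_ ≫ ·) hg

theorem specMap_preimage (φ : 𝔹₁ ⟶ 𝔹₂) {p : BasicPair U 𝔹₁.unop} {C : ℬ}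
    {m : 𝔹₂.unop.presheaf.obj (op ((Opens.map φ.unop.hom.base).obj p.u)) ⟶ C}
    (hm : IsBasic U m) {k : p.cod ⟶ C} (h : IsPushout (φ.unop.hom.c.app (op p.u)) p.n m k) :
    (Opens.map (specMap S hL φ).hom.hom.base).obj (basicOpen L p) =
      basicOpen L ⟨(Opens.map φ.unop.hom.base).obj p.u, C, m, hm⟩ :=
  Opens.ext (Set.ext fun y => (Eq.to_iff (congrArg (· ∈ basicSet L p)
    (congrArg Sigma.fst (specMap_point S hL φ y)))).trans (specPoint_mem_basicSet φ hm h y))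

/-- After composition with `p.n` both sides are the comorphism of `(S 𝔹₂.unop).toSpace ≫ φ.unop`,
and `p.n` can be cancelled by `hom_ext_sections`. -/
theorem toSections_specMap (φ : 𝔹₁ ⟶ 𝔹₂) {p : BasicPair U 𝔹₁.unop} {q : BasicPair U 𝔹₂.unop}
    (hq : q.u ≤ (Opens.map φ.unop.hom.base).obj p.u) {k : p.cod ⟶ q.cod}
    (hk : p.n ≫ k = sectionMap φ.unop p.u q.u hq ≫ q.n)
    (h : basicOpen L q ≤ (Opens.map (specMap S hL φ).hom.hom.base).obj (basicOpen L p)) :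
    (S 𝔹₁.unop).toSections p ≫ sectionMap (specMap S hL φ).hom (basicOpen L p) (basicOpen L q) h =
      k ≫ (S 𝔹₂.unop).toSections q := by
  refine p.isBasic.hom_ext_sections hL (S 𝔹₂.unop).stalkIso (S 𝔹₂.unop).isSheaf ?_
  have hle := (S 𝔹₁.unop).basicOpen_le p
  refine (Category.assoc _ _ _).symm.trans ((congrArg (· ≫ _)
    ((S 𝔹₁.unop).sectionMap_toSpace p hle).symm).trans ?_)
  refine (sectionMap_comp (specMap S hL φ).hom (S 𝔹₁.unop).toSpace hle h).trans ?_
  refine (sectionMap_congr (specMap_toSpace S hL φ) _).trans ?_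
  refine (sectionMap_comp (S 𝔹₂.unop).toSpace φ.unop hq
    ((S 𝔹₂.unop).basicOpen_le q)).symm.trans ?_
  refine (congrArg (_ ≫ ·) ((S 𝔹₂.unop).sectionMap_toSpace q _)).trans ?_
  exact (Category.assoc _ _ _).symm.trans ((congrArg (· ≫ _) hk.symm).trans (Category.assoc _ _ _))

/-- The spectrum functor. -/
def specFunctor : SpecFunctor S where
  map := specMap S hL
  map_id := specMap_id S hL
  map_comp := specMap_comp S hL
  map_point φ y := exists_eqToHom_of_sigma_eq (f := fun z : Point L _ => L.obj z.2)
    (specMap_point S hL φ y)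
  map_sections {𝔹₁ 𝔹₂} φ p C m hm k h := by
    refine ⟨specMap_preimage S hL φ hm h, ?_⟩
    let q : BasicPair U 𝔹₂.unop := ⟨(Opens.map φ.unop.hom.base).obj p.u, C, m, hm⟩
    have e := specMap_preimage S hL φ hm h
    have hk : p.n ≫ k = sectionMap φ.unop p.u q.u le_rfl ≫ q.n :=
      h.w.symm.trans (congrArg (· ≫ m) (sectionMap_preimage φ.unop p.u).symm)
    refine (congrArg (_ ≫ ·) (sectionMap_preimage (specMap S hL φ).hom (basicOpen L p)).symm).trans ?_
    refine Eq.trans ?_ ((congrArg (· ≫ (S 𝔹₂.unop).sheaf.map (homOfLE e.le).op)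
      (toSections_specMap S hL φ (q := q) le_rfl hk e.ge)).trans (Category.assoc _ _ _))
    refine Eq.trans (congrArg (_ ≫ ·) ?_) (Category.assoc _ _ _).symm
    exact (sectionMap_res (specMap S hL φ).hom e.ge e.le).symm

/-- The bijection between the morphisms from the spectrum and the morphisms of `ℬ`-spaces. -/
def specHomEquiv (𝔹 : BSpace ℬ) (Y : USpace U) :
    ((S 𝔹.unop).spectrum ⟶ Y) ≃ (𝔹 ⟶ (forgetLocal U).obj Y) where
  toFun g := (USpace.Hom.hom g ≫ (S 𝔹.unop).toSpace).op
  invFun φ := (S 𝔹.unop).lift hL φ.unop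
  left_inv _ := (S 𝔹.unop).lift_unique hL ((S 𝔹.unop).lift_toSpace hL _)
  right_inv φ := congrArg Quiver.Hom.op ((S 𝔹.unop).lift_toSpace hL φ.unop)

/-- The spectrum functor is left adjoint to the forgetful functor. -/
def specAdjunction : (specFunctor S hL).functor ⊣ forgetLocal U :=
  Adjunction.mkOfHomEquiv
    { homEquiv := specHomEquiv S hL
      homEquiv_naturality_left_symm := fun {𝔹' 𝔹 Y} f g => by
        refine (specHomEquiv S hL 𝔹' Y).injective ((Equiv.apply_symm_apply _ _).trans ?_)
        refine congrArg Quiver.Hom.op ?_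
        change g.unop ≫ f.unop =
          (((S 𝔹.unop).lift hL g.unop).hom ≫ (specMap S hL f).hom) ≫ (S 𝔹'.unop).toSpace
        rw [Category.assoc, specMap_toSpace, ← Category.assoc, (S 𝔹.unop).lift_toSpace hL g.unop]
        rfl
      homEquiv_naturality_right := fun _ _ =>
        congrArg Quiver.Hom.op (Category.assoc _ _ _) }

theorem specAdjunction_unit_app (𝔹 : BSpace ℬ) :
    (specAdjunction S hL).unit.app 𝔹 = (S 𝔹.unop).toSpace.op :=
  congrArg Quiver.Hom.op (Category.id_comp (S 𝔹.unop).toSpace)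

end

end Diers

end

theorem mainTheorem2 {𝒜 : Type u'} [Category.{v'} 𝒜] {ℬ : Type u} [Category.{v} ℬ]
    [IsLocallyFinitelyPresentable.{v} ℬ]
    (U : 𝒜 ⥤ ℬ) (L : Diers.LocalUnits U) (hL : Diers.DiersCondition L) :
    (∀ 𝔹 : SheafedSpace.{u, v, v} ℬ,
      IsTopologicalBasis
        (Set.range (Diers.basicSet L : Diers.BasicPair U 𝔹 → Set (Diers.Point L 𝔹))) ∧
      (∀ x : 𝔹, @Topology.IsEmbedding _ _ (Diers.spectralTopology L (𝔹.presheaf.stalk x)) _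
        (Diers.stalkInclusion L 𝔹 x)) ∧
      Nonempty (Diers.StructuralSheaf L 𝔹)) ∧
    ∀ S : (∀ 𝔹 : SheafedSpace.{u, v, v} ℬ, Diers.StructuralSheaf L 𝔹),
      ∃ (Spec : Diers.SpecFunctor S) (adj : Spec.functor ⊣ Diers.forgetLocal U),
        ∀ 𝔹 : Diers.BSpace ℬ, Diers.IsCanonicalUnit (S 𝔹.unop) (adj.unit.app 𝔹) := by
  refine ⟨fun 𝔹 => ⟨Diers.isTopologicalBasis_basicSet L, Diers.isEmbedding_stalkInclusion L,
    Diers.nonempty_structuralSheaf hL 𝔹⟩, fun S => ⟨Diers.specFunctor S hL,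
    Diers.specAdjunction S hL, fun 𝔹 => ?_⟩⟩
  rw [Diers.specAdjunction_unit_app]
  exact Diers.StructuralSheaf.isCanonicalUnit_toSpace (S 𝔹.unop)
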